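/- All graphs are finite and simple. A correspondence-cover of a graph $G$ is a pair $(L,H)$ of a graph $H$ and a map $L:V(G)\to 2^{V(H)}$ such that the sets $L(v)$ partition $V(H)$, each $L(v)$ is a clique of $H$, and for distinct $u,v$ the edges of $H$ between $L(u)$ and $L(v)$ form a (possibly empty) matching if $uv\in E(G)$, while there are none if $uv\notin E(G)$. It is $k$-fold if $|L(v)|=k$ for every $v$. A $k$-list-assignment $L$ (a finite set $L(v)$ of $k$ colours for each $v$) gives the $k$-fold list-cover with vertices $(v,x)$, $x\in L(v)$, in which $(u,x)$ and $(v,y)$ are adjacent iff $u=v$ and $x\ne y$, or $uv\in E(G)$ and $x=y$. The fractional chromatic number $\chi_f(H)$ is the minimum total weight of a nonnegative weighting of the independent sets of $H$ in which every vertex lies in independent sets of total weight at least $1$. Define the following as the least integers $k\ge 1$ with the given property. - $\chi_\ell^\bullet(G)$: every $k$-fold list-cover $H$ of $G$ has $\chi_f(H)=k$. - $\chi_c^\bullet(G)$: every $k$-fold correspondence-cover $(L,H)$ of $G$ has $\chi_f(H)=k$. - $\chi_\ell^\star(G)$: for every $k$-list-assignment $L$ there are $k$ proper colourings $c_1,\dots,c_k$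 of $G$ with $c_i(v)\in L(v)$ for all $i$ and $v$, and $c_i(v)\neq c_j(v)$ for all $v$ and all $i\ne j$. - $\chi_c^\star(G)$: every $k$-fold correspondence-cover $(L,H)$ of $G$ has $\chi(H)=k$. The degeneracy $\delta^\star(G)$ is the least $d$ such that every nonempty set $S$ of vertices contains a vertex with at most $d$ neighbours in $S$. **Theorem.** (i) For each $d\ge 2$ there is a graph $G$ with $\delta^\star(G)=d$ and $\chi_\ell^\bullet(G)\ge d+2$. (ii) For each $k\ge 2$ there is a graph $G$ with $\chi_c^\bullet(G)=k+1$ and $\chi_c^\star(G)=2k$. (iii) There is a connected $3$-regular graph $G\ne K_4$ with $\chi_\ell^\bullet(G)=\chi_\ell^\star(G)=4$. Specifically, this holds for the $K_4^-$-necklace: take two disjoint copies of $K_4$ minus an edge $ab$, and join the two copies of $a$ by an edge and the two copies of $b$ by an edge. -/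

import Mathlib

namespace ListPacking

/-- `(L, H)` is a correspondence-cover of the graph `G`. -/
structure IsCorrCover {V W : Type} (G : SimpleGraph V) (H : SimpleGraph W)
    (L : V → Finset W) : Prop where
  /-- the parts cover all vertices of `H` -/
  cover : ∀ x : W, ∃ v : V, x ∈ L v
  /-- distinct parts are disjoint -/
  disj : ∀ u v : V, u ≠ v → Disjoint (L u) (L v)
  /-- no edges between the parts of distinct non-adjacent vertices -/
  empty : ∀ u v : V, u ≠ v → ¬ G.Adj u v → ∀ x ∈ L u, ∀ y ∈ L v, ¬ H.Adj x y
  /-- the edges between the parts of adjacent vertices form a matching (as adjacency in `G` is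
  symmetric, this bounds the number of edges at vertices on both sides) -/
  matching : ∀ u v : V, G.Adj u v → ∀ x ∈ L u, ∀ y ∈ L v, ∀ z ∈ L v,
    H.Adj x y → H.Adj x z → y = z
  /-- each part is a clique -/
  clique : ∀ v : V, H.IsClique (L v : Set W)

/-- The cover graph of the list-assignment `L` of `G`: its vertices are the pairs `(v, x)` with
`x ∈ L v`. -/
def listCover {V : Type} (G : SimpleGraph V) (L : V → Finset ℕ) :
    SimpleGraph (Σ v : V, {x : ℕ // x ∈ L v}) where
  Adj p q := (p.1 = q.1 ∧ p ≠ q) ∨ (G.Adj p.1 q.1 ∧ p.2.val = q.2.val)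
  symm := ⟨fun _ _ h => h.imp (fun h => ⟨h.1.symm, h.2.symm⟩) (fun h => ⟨h.1.symm, h.2.symm⟩)⟩
  loopless := ⟨fun _ h => h.elim (fun h => h.2 rfl) (fun h => G.irrefl h.1)⟩

open Classical in
/-- `w` is a fractional colouring of `H`: a nonnegative weighting of the independent sets such that
every vertex lies in independent sets of total weight at least `1`. -/
structure IsFracColouring {W : Type} [Fintype W] (H : SimpleGraph W)
    (w : Finset W → ℝ) : Prop where
  nonneg : ∀ S, 0 ≤ w S
  indep : ∀ S, w S ≠ 0 → H.IsIndepSet (S : Set W)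
  covers : ∀ x : W, 1 ≤ ∑ S : Finset W with x ∈ S, w S

/-- The fractional chromatic number `χ_f(H)`: the minimum total weight of a fractional
colouring. -/
noncomputable def fracChromaticNumber {W : Type} [Fintype W] (H : SimpleGraph W) : ℝ :=
  sInf {t : ℝ | ∃ w : Finset W → ℝ, IsFracColouring H w ∧ t = ∑ S : Finset W, w S}

/-- `c` is a proper `L`-colouring of `G`. -/
def IsListColouring {V : Type} (G : SimpleGraph V) (L : V → Finset ℕ) (c : V → ℕ) : Prop :=
  (∀ v, c v ∈ L v) ∧ ∀ u v, G.Adj u v → c u ≠ c v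

/-- The list packing number `χ_ℓ*(G)`: the least `k ≥ 1` such that every `k`-list-assignment `L`
admits `k` pairwise disjoint proper `L`-colourings. -/
noncomputable def listPackingNumber {V : Type} (G : SimpleGraph V) : ℕ :=
  sInf {k : ℕ | 1 ≤ k ∧ ∀ L : V → Finset ℕ, (∀ v, (L v).card = k) →
    ∃ c : Fin k → V → ℕ, (∀ i, IsListColouring G L (c i)) ∧
      ∀ i j, i ≠ j → ∀ v, c i v ≠ c j v}

/-- The correspondence packing number `χ_c*(G)`: the least `k ≥ 1` such that every `k`-fold
correspondence-cover of `G` has chromatic number `k`. -/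
noncomputable def corrPackingNumber {V : Type} (G : SimpleGraph V) : ℕ :=
  sInf {k : ℕ | 1 ≤ k ∧ ∀ (W : Type) [Fintype W] (H : SimpleGraph W) (L : V → Finset W),
    IsCorrCover G H L → (∀ v, (L v).card = k) → H.chromaticNumber = (k : ℕ∞)}

/-- The fractional list packing number: the least `k ≥ 1` such that every `k`-fold list-cover of
`G` has fractional chromatic number `k`. -/
noncomputable def fracListPackingNumber {V : Type} [Fintype V] (G : SimpleGraph V) : ℕ :=
  sInf {k : ℕ | 1 ≤ k ∧ ∀ L : V → Finset ℕ, (∀ v, (L v).card = k) →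
    fracChromaticNumber (listCover G L) = (k : ℝ)}

/-- The fractional correspondence packing number: the least `k ≥ 1` such that every `k`-fold
correspondence-cover of `G` has fractional chromatic number `k`. -/
noncomputable def fracCorrPackingNumber {V : Type} (G : SimpleGraph V) : ℕ :=
  sInf {k : ℕ | 1 ≤ k ∧ ∀ (W : Type) [Fintype W] (H : SimpleGraph W) (L : V → Finset W),
    IsCorrCover G H L → (∀ v, (L v).card = k) → fracChromaticNumber H = (k : ℝ)}

open Classical in
/-- The degeneracy of `G`: the least `d` such that every nonempty set of vertices contains
a vertex with at most `d` neighbours in that set. -/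
noncomputable def degeneracy {V : Type} [Fintype V] (G : SimpleGraph V) : ℕ :=
  sInf {d : ℕ | ∀ S : Finset V, S.Nonempty → ∃ v ∈ S, {u ∈ S | G.Adj v u}.card ≤ d}

/-- The `K₄⁻`-necklace: two copies (indexed by `Bool`) of the complete graph on `Fin 4` with the
edge `{0, 1}` removed, together with the two edges that join the copies of the vertex `0` and the
copies of the vertex `1`. -/
def necklace : SimpleGraph (Bool × Fin 4) where
  Adj p q :=
    (p.1 = q.1 ∧ p.2 ≠ q.2 ∧ ¬ (p.2 = 0 ∧ q.2 = 1) ∧ ¬ (p.2 = 1 ∧ q.2 = 0)) ∨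
    (p.1 ≠ q.1 ∧ p.2 = q.2 ∧ (p.2 = 0 ∨ p.2 = 1))
  symm := ⟨by decide⟩
  loopless := ⟨by decide⟩

instance : DecidableRel necklace.Adj := fun p q =>
  inferInstanceAs (Decidable
    ((p.1 = q.1 ∧ p.2 ≠ q.2 ∧ ¬ (p.2 = 0 ∧ q.2 = 1) ∧ ¬ (p.2 = 1 ∧ q.2 = 0)) ∨
      (p.1 ≠ q.1 ∧ p.2 = q.2 ∧ (p.2 = 0 ∨ p.2 = 1))))

end ListPacking

/-! Each part of a `k`-fold cover is a `k`-clique, so an independent set meets it at most once. Over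
a nonempty vertex set, double counting therefore shows that `χ_f = k` exactly when the independent
transversals carry nonnegative weights giving every vertex of the cover total weight 1
(`fracChromaticNumber_eq_of_weights`, `exists_weights_of_fracChromaticNumber_eq`). Upper bounds
construct such weights, often from a packing found by Hall's theorem; lower bounds refute them.

(i) In a chain of `(d+1)`-cliques with lists of size `d + 1`, each clique uses its whole list.
Consecutive lists differ in one colour, and uniform weights force the vertices `0` to keep the index
of their colour along the whole chain (`chain_step`). Each of the indices 0 and 1 runs through all
colours below `d` at the neighbours of `none`, so each forces the colour `d` there: weight 2 would
sit on an event of weight 1.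

(ii) Take a complete bipartite graph with `k` left vertices and a right vertex for every tuple of
matchings. With `2k` colours a right vertex satisfies Hall's condition whatever the left packing is;
with `m < 2k`, some right vertex sees an `r × r` forbidden rectangle with `2r > m`. Fractionally, `k
+ 1` colours always leave one free at a right vertex, and a translation-equivariant choice of it is
uniform; with at most `k` colours every left transversal blocks some right vertex.

(iii) Four colours suffice on the necklace: the two ends of a diamond are coloured alike wherever
their lists allow, and such a packing extends to the middle vertices (`exists_matched_avoiding`,
`exists_diamond_extension`). For three colours, explicit lists restrict the pairs at the ends of
each diamond so far that the joining edges give a weight contradiction (`necklace_inequality`). -/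

namespace ListPacking

open Finset Function

/-! ### Hall's theorem with forbidden pairs -/

section Hall

variable {ι α : Type*} [Fintype ι]

/-- Hall's theorem in terms of forbidden rectangles. -/
theorem exists_injective_avoiding (A : Finset α) (hA : #A = Fintype.card ι)
    (r : ι → α → Prop)
    (h : ∀ S : Finset ι, ∀ T ⊆ A, (∀ i ∈ S, ∀ a ∈ T, r i a) → #S + #T ≤ #A) :
    ∃ f : ι → α, Injective f ∧ ∀ i, f i ∈ A ∧ ¬ r i (f i) := by
  classical
  obtain ⟨f, hf, hf'⟩ := (Finset.all_card_le_biUnion_card_iff_exists_injective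
    (fun i => {a ∈ A | ¬ r i a})).1 (by
      intro S
      have h1 := h S {a ∈ A | ∀ i ∈ S, r i a} (filter_subset _ _)
        (fun i hi a ha => (mem_filter.1 ha).2 i hi)
      have h2 : S.biUnion (fun i => {a ∈ A | ¬ r i a}) = {a ∈ A | ¬ ∀ i ∈ S, r i a} := by
        ext a
        simp only [mem_biUnion, mem_filter, not_forall]
        constructor
        · rintro ⟨i, hi, ha, hr⟩
          exact ⟨ha, i, hi, hr⟩
        · rintro ⟨ha, i, hi, hr⟩
          exact ⟨i, hi, ha, hr⟩
      have h3 := card_filter_add_card_filter_not (s := A) (fun a => ∀ i ∈ S, r i a)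
      rw [h2]
      omega)
  exact ⟨f, hf, fun i => mem_filter.1 (hf' i)⟩

/-- Both sides of a nonempty forbidden rectangle are at most half of `#A`, so Hall's condition
holds. -/
theorem exists_injective_avoiding_of_half (A : Finset α) (hA : #A = Fintype.card ι)
    (r : ι → α → Prop)
    (hrow : ∀ i, ∀ T ⊆ A, (∀ a ∈ T, r i a) → 2 * #T ≤ #A)
    (hcol : ∀ a ∈ A, ∀ S : Finset ι, (∀ i ∈ S, r i a) → 2 * #S ≤ #A) :
    ∃ f : ι → α, Injective f ∧ ∀ i, f i ∈ A ∧ ¬ r i (f i) := by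
  refine exists_injective_avoiding A hA r fun S T hT hST => ?_
  rcases S.eq_empty_or_nonempty with rfl | ⟨i, hi⟩
  · simpa using card_le_card hT
  rcases T.eq_empty_or_nonempty with rfl | ⟨a, ha⟩
  · simpa [hA] using card_le_univ S
  have h1 := hrow i T hT (hST i hi)
  have h2 := hcol a (hT ha) S (fun i hi => hST i hi a ha)
  omega

end Hall

/-! ### Fractional colourings of covers and uniform weights on transversals -/

section Fractional

open Classical in
/-- The minimum in the definition of the fractional chromatic number is attained. -/
theorem exists_fracColouring {W : Type} [Fintype W] (H : SimpleGraph W) :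
    ∃ w, IsFracColouring H w ∧ fracChromaticNumber H = ∑ S, w S := by
  -- The singletons give a feasible weighting. Its total `t₀` confines every competitor to a compact
  -- box.
  set w₀ : Finset W → ℝ := fun S => if #S = 1 then 1 else 0 with hw₀
  have h0 : IsFracColouring H w₀ := by
    refine ⟨fun S => ?_, fun S hS => ?_, fun x => ?_⟩
    · simp only [hw₀]; split_ifs <;> norm_num
    · have : #S = 1 := by
        by_contra hne
        exact hS (by simp [hw₀, hne])
      obtain ⟨x, rfl⟩ := card_eq_one.1 this
      simp
    · have := single_le_sum (f := w₀) (s := ({S : Finset W | x ∈ S} : Finset _))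
        (fun S _ => by simp only [hw₀]; split_ifs <;> norm_num)
        (show {x} ∈ ({S : Finset W | x ∈ S} : Finset _) by simp)
      simpa [hw₀] using this
  set t₀ := ∑ S, w₀ S
  have hclosed : IsClosed {w : Finset W → ℝ | IsFracColouring H w} := by
    have : {w : Finset W → ℝ | IsFracColouring H w} =
        (⋂ S : Finset W, {w | 0 ≤ w S}) ∩ (⋂ S : Finset W, {w | w S ≠ 0 → H.IsIndepSet (S : Set W)}) ∩
          ⋂ x : W, {w | 1 ≤ ∑ S : Finset W with x ∈ S, w S} := by
      ext w
      simp only [Set.mem_ofPred_eq, Set.mem_inter_iff, Set.mem_iInter]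
      exact ⟨fun h => ⟨⟨h.1, h.2⟩, h.3⟩, fun h => ⟨h.1.1, h.1.2, h.2⟩⟩
    rw [this]
    refine ((isClosed_iInter fun S => ?_).inter (isClosed_iInter fun S => ?_)).inter
      (isClosed_iInter fun x => ?_)
    · exact isClosed_le continuous_const (continuous_apply S)
    · by_cases hS : H.IsIndepSet (S : Set W)
      · simp [hS]
      · simpa [hS] using isClosed_eq (continuous_apply S) continuous_const
    · exact isClosed_le continuous_const (continuous_finsetSum _ fun S _ => continuous_apply S)
  have hcompact : IsCompact ({w : Finset W → ℝ | IsFracColouring H w} ∩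
      Set.Icc 0 (fun _ => t₀)) := by
    rw [Set.inter_comm]
    exact isCompact_Icc.inter_right hclosed
  have hle : ∀ w, IsFracColouring H w → ∑ S, w S ≤ t₀ → w ∈ Set.Icc 0 (fun _ => t₀) :=
    fun w hw ht => ⟨fun S => hw.nonneg S, fun S =>
      (single_le_sum (fun S _ => hw.nonneg S) (mem_univ S)).trans ht⟩
  obtain ⟨w, hw, hmin⟩ := hcompact.exists_isMinOn ⟨w₀, h0, hle w₀ h0 le_rfl⟩
    (f := fun w => ∑ S, w S)
    (continuous_finsetSum _ fun S _ => continuous_apply S).continuousOn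
  refine ⟨w, hw.1, le_antisymm ?_ ?_⟩
  · exact csInf_le ⟨0, by rintro _ ⟨w, hw, rfl⟩; exact sum_nonneg fun S _ => hw.nonneg S⟩
      ⟨w, hw.1, rfl⟩
  · refine le_csInf ⟨_, w₀, h0, rfl⟩ ?_
    rintro _ ⟨w', hw', rfl⟩
    have hw0 : ∑ S, w S ≤ t₀ := hmin (show w₀ ∈ _ from ⟨h0, hle w₀ h0 le_rfl⟩)
    rcases le_total (∑ S, w' S) t₀ with h | h
    · exact hmin (show w' ∈ _ from ⟨hw', hle w' hw' h⟩)
    · exact hw0.trans h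

variable {V W : Type} {G : SimpleGraph V} {H : SimpleGraph W} {L : V → Finset W}

open Classical in
theorem sum_sum_mem_eq [Fintype W] (w : Finset W → ℝ) (A : Finset W) :
    ∑ x ∈ A, ∑ S : Finset W with x ∈ S, w S = ∑ S, #(A ∩ S) * w S := by
  simp only [sum_filter]
  rw [sum_comm]
  refine sum_congr rfl fun S _ => ?_
  rw [← sum_filter, sum_const, nsmul_eq_mul, filter_mem_eq_inter]

open Classical in
theorem card_inter_mul_le [Fintype W] {w : Finset W → ℝ} (hw : IsFracColouring H w)
    {A : Finset W} (hA : H.IsClique (A : Set W)) (S : Finset W) :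
    #(A ∩ S) * w S ≤ w S := by
  by_cases h0 : w S = 0
  · simp [h0]
  have : #(A ∩ S) ≤ 1 := by
    refine card_le_one.2 fun x hx y hy => by_contra fun hne => ?_
    rw [mem_inter] at hx hy
    exact hw.indep S h0 hx.2 hy.2 hne (hA hx.1 hy.1 hne)
  have h1 : (#(A ∩ S) : ℝ) ≤ 1 := by exact_mod_cast this
  nlinarith [hw.nonneg S]

theorem card_le_sum_of_isClique [Fintype W] {w : Finset W → ℝ} (hw : IsFracColouring H w)
    {A : Finset W} (hA : H.IsClique (A : Set W)) : (#A : ℝ) ≤ ∑ S, w S := by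
  classical
  calc (#A : ℝ) = ∑ x ∈ A, 1 := by simp
    _ ≤ ∑ x ∈ A, ∑ S : Finset W with x ∈ S, w S :=
        sum_le_sum fun x _ => by convert hw.covers x
    _ = ∑ S, #(A ∩ S) * w S := sum_sum_mem_eq w A
    _ ≤ ∑ S, w S := sum_le_sum fun S _ => card_inter_mul_le hw hA S

open Classical in
/-- A cover whose parts have size `k` has fractional chromatic number `k` if some weighting of
independent transversals gives every vertex the weight `1`. -/
theorem fracChromaticNumber_eq_of_weights [Fintype W] [Nonempty V] (hc : IsCorrCover G H L)
    {k : ℕ} (hk : ∀ v, #(L v) = k) {Ω : Type} [Fintype Ω] (w : Ω → ℝ) (hw : ∀ ω, 0 ≤ w ω)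
    (c : Ω → V → W) (hmem : ∀ ω v, c ω v ∈ L v) (hind : ∀ ω u v, ¬ H.Adj (c ω u) (c ω v))
    (hunif : ∀ v, ∀ x ∈ L v, ∑ ω with c ω v = x, w ω = 1) :
    fracChromaticNumber H = k := by
  obtain ⟨v₀⟩ := ‹Nonempty V›
  -- Push the weights forward to the images of the transversals, as sets.
  set w' : Finset W → ℝ := fun S => ∑ ω with ({x | ∃ v, c ω v = x} : Finset W) = S, w ω
  have hw' : IsFracColouring H w' := by
    refine ⟨fun S => sum_nonneg fun ω _ => hw ω, fun S hS => ?_, fun x => ?_⟩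
    · obtain ⟨ω, hω, -⟩ := exists_ne_zero_of_sum_ne_zero hS
      rw [mem_filter] at hω
      rw [← hω.2]
      intro x hx y hy _
      simp only [coe_filter, mem_univ, true_and, Set.mem_ofPred_eq] at hx hy
      obtain ⟨u, rfl⟩ := hx
      obtain ⟨v, rfl⟩ := hy
      exact hind ω u v
    · obtain ⟨v, hv⟩ := hc.cover x
      have h1 : ∑ S : Finset W with x ∈ S, w' S =
          ∑ ω, if ∃ v, c ω v = x then w ω else 0 := by
        rw [sum_filter, ← sum_fiberwise univ
          (fun ω => ({x | ∃ v, c ω v = x} : Finset W)) (fun ω => if ∃ v, c ω v = x then w ω else 0)]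
        refine sum_congr rfl fun S _ => ?_
        split_ifs with hx
        · refine sum_congr rfl fun ω hω => ?_
          rw [← (mem_filter.1 hω).2] at hx
          rw [if_pos (by simpa using hx)]
        · refine (sum_eq_zero fun ω hω => ?_).symm
          rw [← (mem_filter.1 hω).2] at hx
          rw [if_neg (by simpa using hx)]
      rw [← hunif v x hv, h1, ← sum_filter]
      refine sum_le_sum_of_subset_of_nonneg (fun ω hω => ?_) fun ω _ _ => hw ω
      simp only [mem_filter, mem_univ, true_and] at hω ⊢
      exact ⟨v, hω⟩
  have htot : ∑ S, w' S = k := by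
    have h1 : ∑ S, w' S = ∑ ω, w ω := sum_fiberwise _ _ _
    rw [h1, ← sum_fiberwise_of_maps_to (t := L v₀) (g := fun ω => c ω v₀)
      (fun ω _ => hmem ω v₀), sum_congr rfl (hunif v₀)]
    simp [hk]
  refine le_antisymm ?_ ?_
  · rw [← htot]
    exact csInf_le ⟨0, by rintro _ ⟨w, hw, rfl⟩; exact sum_nonneg fun S _ => hw.nonneg S⟩
      ⟨w', hw', rfl⟩
  · refine le_csInf ⟨_, w', hw', rfl⟩ ?_
    rintro _ ⟨w, hw, rfl⟩
    rw [← hk v₀]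
    exact card_le_sum_of_isClique hw (hc.clique v₀)

open Classical in
/-- If a cover whose parts have size `k` has fractional chromatic number `k`, then some positive
weighting of independent transversals gives every vertex the weight `1`. -/
theorem exists_weights_of_fracChromaticNumber_eq [Fintype W] (hc : IsCorrCover G H L)
    {k : ℕ} (hk : ∀ v, #(L v) = k) (h : fracChromaticNumber H = k) :
    ∃ (Ω : Type) (_ : Fintype Ω) (w : Ω → ℝ) (c : Ω → V → W), (∀ ω, 0 < w ω) ∧
      (∀ ω v, c ω v ∈ L v) ∧ (∀ ω u v, ¬ H.Adj (c ω u) (c ω v)) ∧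
      ∀ v, ∀ x ∈ L v, ∑ ω with c ω v = x, w ω = 1 := by
  obtain ⟨w, hw, hsum⟩ := exists_fracColouring H
  rw [h] at hsum
  -- The part has `k` vertices of weight at least 1, while counted by independent sets it carries at
  -- most the total `k`; so both estimates are equalities.
  have key : ∀ v, (∑ x ∈ L v, ∑ S : Finset W with x ∈ S, w S = ∑ x ∈ L v, (1 : ℝ)) ∧
      ∑ S, #(L v ∩ S) * w S = ∑ S, w S := by
    intro v
    have h1 : ∑ x ∈ L v, (1 : ℝ) ≤ ∑ x ∈ L v, ∑ S : Finset W with x ∈ S, w S :=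
      sum_le_sum fun x _ => hw.covers x
    have h2 : ∑ S, #(L v ∩ S) * w S ≤ ∑ S, w S :=
      sum_le_sum fun S _ => card_inter_mul_le hw (hc.clique v) S
    have h3 : ∑ x ∈ L v, (1 : ℝ) = k := by simp [hk]
    have h4 := sum_sum_mem_eq w (L v)
    constructor <;> linarith
  have hone : ∀ v, ∀ x ∈ L v, ∑ S : Finset W with x ∈ S, w S = 1 := fun v x hx =>
    ((sum_eq_sum_iff_of_le fun x _ => hw.covers x).1 (key v).1.symm x hx).symm
  have hcard : ∀ v S, 0 < w S → #(L v ∩ S) = 1 := by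
    intro v S hS
    have := (sum_eq_sum_iff_of_le fun S _ => card_inter_mul_le hw (hc.clique v) S).1
      (key v).2 S (mem_univ S)
    have h1 : (#(L v ∩ S) : ℝ) = 1 := by
      field_simp at this
      exact this
    exact_mod_cast h1
  choose c hc' using fun (S : {S : Finset W // 0 < w S}) v => card_eq_one.1 (hcard v S.1 S.2)
  have hc1 : ∀ S v x, x ∈ L v → (c S v = x ↔ x ∈ S.1) := by
    intro S v x hx
    have := hc' S v
    rw [Finset.ext_iff] at this
    have := this x
    simp only [mem_inter, hx, true_and, mem_singleton] at this
    rw [this, eq_comm]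
  have hc2 : ∀ S v, c S v ∈ L v ∧ c S v ∈ S.1 := fun S v => by
    rw [← mem_inter, hc' S v]; exact mem_singleton_self _
  refine ⟨{S : Finset W // 0 < w S}, inferInstance, fun S => w S.1, c, fun S => S.2,
    fun S v => (hc2 S v).1, fun S u v hadj => ?_, fun v x hx => ?_⟩
  · exact hw.indep S.1 S.2.ne' (hc2 S u).2 (hc2 S v).2 hadj.ne hadj
  · rw [← hone v x hx, sum_filter, sum_filter]
    simp only [hc1 _ v x hx]
    rw [← sum_subtype ({S | 0 < w S} : Finset (Finset W)) (by simp)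
      (fun S => if x ∈ S then w S else 0)]
    refine sum_subset (subset_univ _) fun S _ hS => ?_
    have : w S = 0 := le_antisymm (by simpa using hS) (hw.nonneg S)
    simp [this]

/-- A partition of the cover graph into independent transversals. -/
structure IsPacking (H : SimpleGraph W) (L : V → Finset W) {k : ℕ} (σ : V → Fin k → W) :
    Prop where
  inj : ∀ v, Injective (σ v)
  mem : ∀ v i, σ v i ∈ L v
  indep : ∀ u v i, ¬ H.Adj (σ u i) (σ v i)

theorem exists_eq_of_injective {k : ℕ} {A : Finset W} (hA : #A = k) {f : Fin k → W}
    (hf : Injective f) (hmem : ∀ i, f i ∈ A) {x : W} (hx : x ∈ A) : ∃ i, f i = x := by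
  obtain ⟨i, -, hi⟩ := surj_on_of_inj_on_of_card_le (s := univ) (t := A) (fun i _ => f i)
    (fun i _ => hmem i) (fun i j _ _ h => hf h) (by simp [hA]) x hx
  exact ⟨i, hi.symm⟩

theorem IsPacking.fracChromaticNumber_eq [Fintype W] [Nonempty V] (hc : IsCorrCover G H L)
    {k : ℕ} (hk : ∀ v, #(L v) = k) {σ : V → Fin k → W} (hσ : IsPacking H L σ) :
    fracChromaticNumber H = k := by
  refine fracChromaticNumber_eq_of_weights hc hk (fun _ : Fin k => 1) (fun _ => zero_le_one)
    (fun i v => σ v i) (fun i v => hσ.mem v i) (fun i u v => hσ.indep u v i) fun v x hx => ?_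
  obtain ⟨i, rfl⟩ := exists_eq_of_injective (hk v) (hσ.inj v) (hσ.mem v) hx
  simp [(hσ.inj v).eq_iff, filter_eq']

theorem IsPacking.colorable (hc : IsCorrCover G H L)
    {k : ℕ} (hk : ∀ v, #(L v) = k) {σ : V → Fin k → W} (hσ : IsPacking H L σ) :
    H.Colorable k := by
  choose v hv using hc.cover
  choose i hi using fun x => exists_eq_of_injective (hk (v x)) (hσ.inj _) (hσ.mem _) (hv x)
  refine ⟨SimpleGraph.Coloring.mk i fun {x y} hxy h => hσ.indep (v x) (v y) (i x) ?_⟩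
  rw [hi, h, hi]
  exact hxy

/-- An independent transversal packing extends to a further vertex with few neighbours. -/
theorem IsCorrCover.exists_extension (hc : IsCorrCover G H L) {k : ℕ} {v : V} (hk : #(L v) = k)
    {U : Finset V} (hv : v ∉ U) (hU : 2 * #U ≤ k) (σ : V → Fin k → W)
    (hinj : ∀ u ∈ U, Injective (σ u)) (hmem : ∀ u ∈ U, ∀ i, σ u i ∈ L u) :
    ∃ f : Fin k → W, Injective f ∧ (∀ i, f i ∈ L v) ∧ ∀ u ∈ U, ∀ i, ¬ H.Adj (σ u i) (f i) := by
  have hadj : ∀ u ∈ U, ∀ i, ∀ x ∈ L v, H.Adj (σ u i) x → G.Adj u v := fun u hu i x hx h =>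
    by_contra fun hn => hc.empty u v (fun h => hv (h ▸ hu)) hn _ (hmem u hu i) x hx h
  -- By the matching condition each `u ∈ U` forbids at most one `x` for each index and at most one
  -- index for each `x`, so rows and columns have at most `#U ≤ k / 2` forbidden entries.
  obtain ⟨f, hf, hf'⟩ := exists_injective_avoiding_of_half (L v) (by simpa using hk)
    (fun i x => ∃ u ∈ U, H.Adj (σ u i) x)
    (fun i T hT h => by
      have : #T ≤ #U := card_le_card_of_forall_subsingleton (fun x u => H.Adj (σ u i) x) h
        fun u hu x hx y hy => by
          have hxv := hT hx.1
          have hyv := hT hy.1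
          exact hc.matching u v (hadj u hu i x hxv hx.2) _ (hmem u hu i) x hxv y hyv hx.2 hy.2
      omega)
    (fun x hx S h => by
      have : #S ≤ #U := card_le_card_of_forall_subsingleton (fun i u => H.Adj (σ u i) x) h
        fun u hu i hi j hj => hinj u hu
          (hc.matching v u (hadj u hu i x hx hi.2).symm x hx _ (hmem u hu i) _ (hmem u hu j)
            hi.2.symm hj.2.symm)
      omega)
  exact ⟨f, hf, fun i => (hf' i).1, fun u hu i h => (hf' i).2 ⟨u, hu, h⟩⟩

/-- Greedy extension, one vertex at a time. -/
theorem IsCorrCover.exists_packing [Fintype V] (hc : IsCorrCover G H L) {k : ℕ}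
    (hk : ∀ v, #(L v) = k) (hV : 2 * Fintype.card V ≤ k) :
    ∃ σ : V → Fin k → W, IsPacking H L σ := by
  classical
  have main : ∀ U : Finset V, ∃ σ : V → Fin k → W, (∀ u ∈ U, Injective (σ u)) ∧
      (∀ u ∈ U, ∀ i, σ u i ∈ L u) ∧ ∀ u ∈ U, ∀ v ∈ U, ∀ i, ¬ H.Adj (σ u i) (σ v i) := by
    intro U
    induction U using Finset.induction_on with
    | empty =>
      refine ⟨fun v i => ((L v).equivFin.symm (Fin.cast (hk v).symm i)).1, ?_⟩
      simp
    | insert v U hv ih =>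
      obtain ⟨σ, h1, h2, h3⟩ := ih
      obtain ⟨f, hf1, hf2, hf3⟩ := hc.exists_extension (hk v) hv
        (by have := card_le_univ U; omega) σ h1 h2
      have hne : ∀ u ∈ U, u ≠ v := fun u hu h => hv (h ▸ hu)
      refine ⟨update σ v f, ?_, ?_, ?_⟩
      · intro u hu
        rcases mem_insert.1 hu with rfl | hu
        · simpa
        · simpa [hne u hu] using h1 u hu
      · intro u hu
        rcases mem_insert.1 hu with rfl | hu
        · simpa
        · simpa [hne u hu] using h2 u hu
      · intro u hu w hw
        rcases mem_insert.1 hu with rfl | hu' <;> rcases mem_insert.1 hw with rfl | hw'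
        · simp
        · simpa [hne w hw', H.adj_comm] using hf3 w hw'
        · simpa [hne u hu'] using hf3 u hu'
        · simpa [hne u hu', hne w hw'] using h3 u hu' w hw'
  obtain ⟨σ, h1, h2, h3⟩ := main univ
  exact ⟨σ, fun v => h1 v (mem_univ v), fun v => h2 v (mem_univ v),
    fun u v => h3 u (mem_univ u) v (mem_univ v)⟩

end Fractional

/-! ### List-covers as correspondence-covers -/

section ListCover

variable {V : Type} {G : SimpleGraph V} {L : V → Finset ℕ}

/-- The parts of the cover graph of a list-assignment. -/
def listPart (L : V → Finset ℕ) (v : V) : Finset (Σ v : V, {x : ℕ // x ∈ L v}) :=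
  (univ : Finset {x : ℕ // x ∈ L v}).map (Embedding.sigmaMk v)

theorem mem_listPart {p : Σ v : V, {x : ℕ // x ∈ L v}} {v : V} : p ∈ listPart L v ↔ p.1 = v := by
  obtain ⟨u, x⟩ := p
  simp only [listPart, mem_map, mem_univ, true_and, Embedding.sigmaMk_apply]
  constructor
  · rintro ⟨y, h⟩
    exact (congrArg Sigma.fst h).symm
  · rintro rfl
    exact ⟨x, rfl⟩

theorem card_listPart (v : V) : #(listPart L v) = #(L v) := by
  simp [listPart]

theorem isCorrCover_listCover (G : SimpleGraph V) (L : V → Finset ℕ) :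
    IsCorrCover G (listCover G L) (listPart L) where
  cover p := ⟨p.1, mem_listPart.2 rfl⟩
  disj u v h := disjoint_left.2 fun p hp hp' =>
    h ((mem_listPart.1 hp).symm.trans (mem_listPart.1 hp'))
  empty u v h hn p hp q hq hpq := by
    rw [mem_listPart] at hp hq
    subst hp hq
    exact hpq.elim (fun h' => h h'.1) fun h' => hn h'.1
  matching u v h p hp q hq r hr hpq hpr := by
    rw [mem_listPart] at hp hq hr
    obtain ⟨q1, q2⟩ := q
    obtain ⟨r1, r2⟩ := r
    dsimp only at hq hr
    subst hp hq hr
    have h1 := hpq.elim (fun h' => (h.ne h'.1).elim) fun h' => h'.2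
    have h2 := hpr.elim (fun h' => (h.ne h'.1).elim) fun h' => h'.2
    exact congrArg (Sigma.mk _) (Subtype.ext (h1.symm.trans h2))
  clique v p hp q hq h := by
    rw [mem_coe, mem_listPart] at hp hq
    exact Or.inl ⟨hp.trans hq.symm, h⟩

theorem fracChromaticNumber_listCover_eq_of_packing [Fintype V] [Nonempty V] {k : ℕ}
    (hk : ∀ v, #(L v) = k) (c : Fin k → V → ℕ) (hc : ∀ i, IsListColouring G L (c i))
    (hne : ∀ i j, i ≠ j → ∀ v, c i v ≠ c j v) :
    fracChromaticNumber (listCover G L) = k := by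
  refine IsPacking.fracChromaticNumber_eq (isCorrCover_listCover G L)
    (fun v => (card_listPart v).trans (hk v)) (σ := fun v i => ⟨v, c i v, (hc i).1 v⟩) ⟨?_, ?_, ?_⟩
  · intro v i j h
    by_contra hij
    refine hne i j hij v ?_
    simpa using h
  · exact fun v i => mem_listPart.2 rfl
  · rintro u v i (⟨rfl, h⟩ | ⟨h, h'⟩)
    · exact h rfl
    · exact (hc i).2 u v h h'

theorem exists_listColouring_weights [Fintype V] {k : ℕ} (hk : ∀ v, #(L v) = k)
    (h : fracChromaticNumber (listCover G L) = k) :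
    ∃ (Ω : Type) (_ : Fintype Ω) (w : Ω → ℝ) (c : Ω → V → ℕ), (∀ ω, 0 < w ω) ∧
      (∀ ω, IsListColouring G L (c ω)) ∧ ∀ v, ∀ x ∈ L v, ∑ ω with c ω v = x, w ω = 1 := by
  obtain ⟨Ω, _, w, c, hw, hmem, hind, hunif⟩ := exists_weights_of_fracChromaticNumber_eq
    (isCorrCover_listCover G L) (fun v => (card_listPart v).trans (hk v)) h
  have hfst : ∀ ω v, (c ω v).1 = v := fun ω v => mem_listPart.1 (hmem ω v)
  refine ⟨Ω, ‹_›, w, fun ω v => (c ω v).2.1, hw, fun ω => ⟨fun v => ?_, fun u v huv he => ?_⟩,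
    fun v x hx => ?_⟩
  · have : ∀ p : Σ v : V, {x : ℕ // x ∈ L v}, p.1 = v → p.2.1 ∈ L v := by
      rintro ⟨_, y⟩ rfl
      exact y.2
    exact this _ (hfst ω v)
  · refine hind ω u v (Or.inr ⟨?_, he⟩)
    rwa [hfst, hfst]
  · refine (sum_congr (Finset.ext fun ω => ?_) fun _ _ => rfl).trans
      (hunif v ⟨v, x, hx⟩ (mem_listPart.2 rfl))
    simp only [mem_filter, mem_univ, true_and]
    have h1 := hfst ω v
    generalize c ω v = p at h1
    obtain ⟨p1, p2⟩ := p
    dsimp only at h1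
    subst h1
    simp [Subtype.ext_iff]

/-- Guards lower bounds against the default value `sInf ∅ = 0`. -/
theorem exists_fracListPacking [Fintype V] [Nonempty V] (G : SimpleGraph V) :
    ∃ k : ℕ, 1 ≤ k ∧ ∀ L : V → Finset ℕ, (∀ v, #(L v) = k) →
      fracChromaticNumber (listCover G L) = (k : ℝ) := by
  refine ⟨2 * Fintype.card V, by have := Fintype.card_pos (α := V); omega, fun L hL => ?_⟩
  have hk : ∀ v, #(listPart L v) = 2 * Fintype.card V := fun v => (card_listPart v).trans (hL v)
  obtain ⟨σ, hσ⟩ := (isCorrCover_listCover G L).exists_packing hk le_rfl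
  exact hσ.fracChromaticNumber_eq (isCorrCover_listCover G L) hk

end ListCover

/-! ### The necklace: four colours suffice, three do not -/

section Necklace

theorem necklace_regular : necklace.IsRegularOfDegree 3 := by
  intro v
  revert v
  decide

theorem necklace_connected : necklace.Connected := by
  have h : ∀ v, necklace.Reachable (false, 2) v := by
    have e : ∀ {u v}, necklace.Adj u v → necklace.Reachable u v := fun h => h.reachable
    have h0 : necklace.Reachable (false, 2) (false, 0) := e (by decide)
    have h1 : necklace.Reachable (false, 2) (true, 2) :=
      (h0.trans (e (by decide : necklace.Adj _ (true, 0)))).trans (e (by decide))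
    have hs : ∀ b i, necklace.Reachable (b, 2) (b, i) := by
      intro b i
      by_cases hi : i = 2
      · rw [hi]
      · exact e (by revert b i; decide)
    rintro ⟨b, i⟩
    cases b
    · exact hs _ i
    · exact h1.trans (hs _ i)
  exact (SimpleGraph.connected_iff_exists_forall_reachable _).2 ⟨_, h⟩

theorem necklace_not_iso : IsEmpty (necklace ≃g (⊤ : SimpleGraph (Fin 4))) :=
  ⟨fun e => by simpa using Fintype.card_congr e.toEquiv⟩

/-- Two vertices with lists `A` and `B` coloured alike on `A ∩ B`. -/
def Matched {k : ℕ} (A B : Finset ℕ) (f g : Fin k → ℕ) : Prop :=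
  ∀ i, (f i ∈ B ∨ g i ∈ A) → f i = g i

/-- Keep the common colours and biject `A \ B` with `B \ A`, which have equal size. -/
theorem exists_equiv_fixing_inter {A B : Finset ℕ} (h : #A = #B) :
    ∃ β : ℕ → ℕ, Set.InjOn β A ∧ (∀ x ∈ A, β x ∈ B) ∧ ∀ x ∈ A, (x ∈ B ∨ β x ∈ A) → β x = x := by
  have h1 : #(A \ B) = #(B \ A) := by
    have := card_sdiff_add_card_inter A B
    have := card_sdiff_add_card_inter B A
    rw [inter_comm] at this
    omega
  let e := equivOfCardEq h1
  refine ⟨fun x => if hx : x ∈ A \ B then (e ⟨x, hx⟩).1 else x, ?_, ?_, ?_⟩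
  · intro x hx y hy hxy
    have hx' : ∀ h : x ∈ A \ B, (e ⟨x, h⟩).1 ∉ A := fun h => (mem_sdiff.1 (e ⟨x, h⟩).2).2
    have hy' : ∀ h : y ∈ A \ B, (e ⟨y, h⟩).1 ∉ A := fun h => (mem_sdiff.1 (e ⟨y, h⟩).2).2
    dsimp only at hxy
    split_ifs at hxy with h1 h2 h2
    · simpa using e.injective (Subtype.ext hxy)
    · exact (hx' h1 (hxy ▸ hy)).elim
    · exact (hy' h2 (hxy ▸ hx)).elim
    · exact hxy
  · intro x hx
    dsimp only
    split_ifs with h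
    · exact (mem_sdiff.1 (e ⟨x, h⟩).2).1
    · by_contra hxB
      exact h (mem_sdiff.2 ⟨hx, hxB⟩)
  · intro x hx h
    dsimp only at h ⊢
    split_ifs at h ⊢ with h1
    · have := mem_sdiff.1 (e ⟨x, h1⟩).2
      rcases h with h | h
      · exact ((mem_sdiff.1 h1).2 h).elim
      · exact (this.2 h).elim
    · rfl

/-- Matched colourings of two vertices can avoid given colourings of a neighbour of each. -/
theorem exists_matched_avoiding {A B : Finset ℕ} (hA : #A = 4) (hB : #B = 4)
    {f g : Fin 4 → ℕ} (hf : Injective f) (hg : Injective g) :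
    ∃ f' g' : Fin 4 → ℕ, Injective f' ∧ Injective g' ∧ (∀ i, f' i ∈ A) ∧ (∀ i, g' i ∈ B) ∧
      Matched A B f' g' ∧ (∀ i, f i ≠ f' i) ∧ ∀ i, g i ≠ g' i := by
  obtain ⟨β, hβ, hβB, hβfix⟩ := exists_equiv_fixing_inter (hA.trans hB.symm)
  -- Only `f'` is chosen, with `g' = β ∘ f'`. Each of the two constraints forbids at most one entry
  -- per row and column, and two is half of four.
  obtain ⟨f', hf', hf''⟩ := exists_injective_avoiding_of_half A (by simpa using hA)
    (fun i x => f i = x ∨ g i = β x)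
    (fun i T hT h => by
      have : #T ≤ #(univ : Finset Bool) := card_le_card_of_forall_subsingleton
        (fun x b => if b then f i = x else g i = β x)
        (fun x hx => by
          rcases h x hx with h | h
          · exact ⟨true, by simp, by simpa⟩
          · exact ⟨false, by simp, by simpa⟩)
        (fun b _ x hx y hy => by
          obtain ⟨hx, hx'⟩ := hx
          obtain ⟨hy, hy'⟩ := hy
          cases b
          · exact hβ (hT hx) (hT hy) (by simp_all)
          · simp_all)
      simp at this
      omega)
    (fun x hx S h => by
      have : #S ≤ #(univ : Finset Bool) := card_le_card_of_forall_subsingleton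
        (fun i b => if b then f i = x else g i = β x)
        (fun i hi => by
          rcases h i hi with h | h
          · exact ⟨true, by simp, by simpa⟩
          · exact ⟨false, by simp, by simpa⟩)
        (fun b _ i hi j hj => by
          obtain ⟨hi, hi'⟩ := hi
          obtain ⟨hj, hj'⟩ := hj
          cases b
          · exact hg (by simp_all)
          · exact hf (by simp_all))
      simp at this
      omega)
  refine ⟨f', fun i => β (f' i), hf', fun i j h => hf' (hβ (hf'' i).1 (hf'' j).1 h),
    fun i => (hf'' i).1, fun i => hβB _ (hf'' i).1, fun i h => (hβfix _ (hf'' i).1 h).symm,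
    fun i h => (hf'' i).2 (Or.inl h), fun i h => (hf'' i).2 (Or.inr h)⟩

theorem Matched.eq_of_eq {k : ℕ} {A B : Finset ℕ} {f g : Fin k → ℕ} (h : Matched A B f g)
    (hf : Injective f) (hfA : ∀ i, f i ∈ A) {i j : Fin k} (hij : f i = g j) : i = j :=
  hf (hij.trans (h j (Or.inr (hij ▸ hfA i))).symm)

/-- Matched colourings of the two non-adjacent vertices of `K₄⁻` extend to the other two. -/
theorem exists_diamond_extension {A B C D : Finset ℕ} (hC : #C = 4) (hD : #D = 4)
    {f g : Fin 4 → ℕ} (hf : Injective f) (hg : Injective g) (hfA : ∀ i, f i ∈ A)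
    (hfg : Matched A B f g) :
    ∃ c d : Fin 4 → ℕ, Injective c ∧ Injective d ∧ (∀ i, c i ∈ C) ∧ (∀ i, d i ∈ D) ∧
      (∀ i, f i ≠ c i) ∧ (∀ i, g i ≠ c i) ∧ (∀ i, f i ≠ d i) ∧ (∀ i, g i ≠ d i) ∧
      ∀ i, c i ≠ d i := by
  -- Being matched pays off here: a colour used at both ends is used at the same index.
  have hcol : ∀ x, ∀ S : Finset (Fin 4), (∀ i ∈ S, f i = x ∨ g i = x) → #S ≤ 1 := by
    intro x S h
    refine card_le_one.2 fun i hi j hj => ?_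
    rcases h i hi with hi | hi <;> rcases h j hj with hj | hj
    · exact hf (hi.trans hj.symm)
    · exact hfg.eq_of_eq hf hfA (hi.trans hj.symm)
    · exact (hfg.eq_of_eq hf hfA (hj.trans hi.symm)).symm
    · exact hg (hi.trans hj.symm)
  obtain ⟨c, hc, hc'⟩ := exists_injective_avoiding_of_half C (by simpa using hC)
    (fun i x => f i = x ∨ g i = x)
    (fun i T _ h => by
      have : #T ≤ #({f i, g i} : Finset ℕ) := card_le_card fun x hx => by
        rcases h x hx with h | h <;> simp [h]
      have := this.trans card_le_two
      omega)
    (fun x _ S h => by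
      have := hcol x S h
      omega)
  obtain ⟨d, hd, hd'⟩ := exists_injective_avoiding D (by simpa using hD)
    (fun i x => (f i = x ∨ g i = x) ∨ c i = x) (by
      intro S T hT h
      rcases T.eq_empty_or_nonempty with rfl | ⟨x, hx⟩
      · simpa [hD] using card_le_univ S
      rcases S.eq_empty_or_nonempty with rfl | ⟨i, hi⟩
      · simpa using card_le_card hT
      have hS : #S ≤ 2 := by
        rw [← card_filter_add_card_filter_not (s := S) (fun i => f i = x ∨ g i = x)]
        have h1 := hcol x {i ∈ S | f i = x ∨ g i = x} fun i hi => (mem_filter.1 hi).2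
        have h2 : #{i ∈ S | ¬ (f i = x ∨ g i = x)} ≤ 1 := card_le_one.2 fun i hi j hj => by
          rw [mem_filter] at hi hj
          exact hc (((h i hi.1 x hx).resolve_left hi.2).trans
            ((h j hj.1 x hx).resolve_left hj.2).symm)
        omega
      -- With `#S ≤ 2` and `#T ≤ 3`, Hall's condition can fail only for a 2 by 3 rectangle. Then `T`
      -- would contain the four distinct colours of the ends at the two indices.
      have hsub : ∀ i ∈ S, T ⊆ {f i, g i, c i} := fun i hi y hy => by
        rcases h i hi y hy with (h | h) | h <;> simp [h]
      have hT3 : #T ≤ 3 := (card_le_card (hsub i hi)).trans card_le_three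
      by_contra hlt
      have hS2 : #S = 2 := by omega
      have hT3 : #T = 3 := by omega
      obtain ⟨i, j, hij, rfl⟩ := card_eq_two.1 hS2
      have hmem : ∀ l ∈ ({i, j} : Finset (Fin 4)), f l ∈ T ∧ g l ∈ T ∧ f l ≠ g l := by
        intro l hl
        have hTi := eq_of_subset_of_card_le (hsub l hl) (card_le_three.trans hT3.ge)
        refine ⟨by simp [hTi], by simp [hTi], fun he => ?_⟩
        rw [hTi, he] at hT3
        have := card_le_two (a := g l) (b := c l)
        simp at hT3
        omega
      obtain ⟨hi1, hi2, hi3⟩ := hmem i (by simp)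
      obtain ⟨hj1, hj2, hj3⟩ := hmem j (by simp)
      have h4 : #({f i, g i, f j, g j} : Finset ℕ) = 4 := by
        have e1 : f i ≠ f j := fun h => hij (hf h)
        have e2 : f i ≠ g j := fun h => hij (hfg.eq_of_eq hf hfA h)
        have e3 : f j ≠ g i := fun h => hij (hfg.eq_of_eq hf hfA h).symm
        have e4 : g i ≠ g j := fun h => hij (hg h)
        rw [card_insert_of_notMem (by simp [hi3, e1, e2]),
          card_insert_of_notMem (by simp [e3.symm, e4]), card_insert_of_notMem (by simp [hj3]),
          card_singleton]
      have h5 : #({f i, g i, f j, g j} : Finset ℕ) ≤ #T := card_le_card (by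
        simp [insert_subset_iff, hi1, hi2, hj1, hj2])
      omega)
  exact ⟨c, d, hc, hd, fun i => (hc' i).1, fun i => (hd' i).1,
    fun i h => (hc' i).2 (Or.inl h), fun i h => (hc' i).2 (Or.inr h),
    fun i h => (hd' i).2 (Or.inl (Or.inl h)), fun i h => (hd' i).2 (Or.inl (Or.inr h)),
    fun i h => (hd' i).2 (Or.inr h)⟩

theorem necklace_packing (L : Bool × Fin 4 → Finset ℕ) (hL : ∀ v, #(L v) = 4) :
    ∃ c : Fin 4 → Bool × Fin 4 → ℕ, (∀ i, IsListColouring necklace L (c i)) ∧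
      ∀ i j, i ≠ j → ∀ v, c i v ≠ c j v := by
  -- The first diamond has nothing to avoid yet, so `Fin.val` is a dummy; the second must avoid the
  -- first along the two joining edges.
  obtain ⟨f, g, hf, hg, hfA, hgB, hfg, -, -⟩ := exists_matched_avoiding
    (hL (false, 0)) (hL (false, 1)) Fin.val_injective Fin.val_injective
  obtain ⟨f', g', hf', hg', hfA', hgB', hfg', hff, hgg⟩ := exists_matched_avoiding
    (hL (true, 0)) (hL (true, 1)) hf hg
  obtain ⟨c, d, hc, hd, hcC, hdD, h1, h2, h3, h4, h5⟩ := exists_diamond_extension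
    (hL (false, 2)) (hL (false, 3)) hf hg hfA hfg
  obtain ⟨c', d', hc', hd', hcC', hdD', h1', h2', h3', h4', h5'⟩ := exists_diamond_extension
    (hL (true, 2)) (hL (true, 3)) hf' hg' hfA' hfg'
  refine ⟨fun i v => cond v.1 (![f', g', c', d'] v.2 i) (![f, g, c, d] v.2 i), ?_, ?_⟩
  · refine fun i => ⟨?_, ?_⟩
    · rintro ⟨b, v⟩
      cases b <;> fin_cases v <;> simp [hfA, hgB, hcC, hdD, hfA', hgB', hcC', hdD']
    · rintro ⟨b, v⟩ ⟨b', v'⟩ h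
      cases b <;> cases b' <;> fin_cases v <;> fin_cases v' <;>
        first
        | exact absurd h (by decide)
        | simp [h1, h2, h3, h4, h5, h1', h2', h3', h4', h5', hff, hgg,
            (h1 _).symm, (h2 _).symm, (h3 _).symm, (h4 _).symm, (h5 _).symm, (h1' _).symm,
            (h2' _).symm, (h3' _).symm, (h4' _).symm, (h5' _).symm, (hff _).symm, (hgg _).symm]
  · rintro i j hij ⟨b, v⟩
    cases b <;> fin_cases v <;>
      simp [hf.ne hij, hg.ne hij, hc.ne hij, hd.ne hij, hf'.ne hij, hg'.ne hij, hc'.ne hij,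
        hd'.ne hij]

/-- Lists of size `3` on the necklace without a fractional packing. -/
def necklaceLists (v : Bool × Fin 4) : Finset ℕ :=
  cond v.1 (![{1, 2, 3}, {1, 3, 4}, {1, 2, 3}, {1, 2, 3}] v.2)
    (![{1, 2, 3}, {1, 3, 4}, {1, 2, 4}, {1, 2, 4}] v.2)

-- In the triangle `a, c, d`, either `a = 3` or the colours 1, 2, 4 all occur, and 4 can only be at
-- `c` or `d`; likewise `b = 3` or 2 is at `c` or `d`. So both brackets are at least 1, and both
-- equal 1 only for the three listed pairs.
set_option synthInstance.maxSize 2000 in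
set_option synthInstance.maxHeartbeats 200000 in
theorem diamond_inequality_left :
    ∀ a ∈ ({1, 2, 3} : Finset ℕ), ∀ b ∈ ({1, 3, 4} : Finset ℕ), ∀ c ∈ ({1, 2, 4} : Finset ℕ),
    ∀ d ∈ ({1, 2, 4} : Finset ℕ), a ≠ c → a ≠ d → b ≠ c → b ≠ d → c ≠ d →
      (if (a, b) = (1, 1) ∨ (a, b) = (2, 3) ∨ (a, b) = (3, 4) then 0 else 1) + (1 + 1) ≤
      ((if a = 3 then 1 else 0) + (if c = 4 then 1 else 0) + (if d = 4 then 1 else 0)) +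
      ((if b = 3 then 1 else 0) + (if c = 2 then 1 else 0) + (if d = 2 then 1 else 0)) := by
  decide

-- In the triangle `b, c, d`, either `b = 4` or 2 is at `c` or `d`; equality again leaves only three
-- pairs.
set_option synthInstance.maxSize 2000 in
set_option synthInstance.maxHeartbeats 200000 in
theorem diamond_inequality_right :
    ∀ a ∈ ({1, 2, 3} : Finset ℕ), ∀ b ∈ ({1, 3, 4} : Finset ℕ), ∀ c ∈ ({1, 2, 3} : Finset ℕ),
    ∀ d ∈ ({1, 2, 3} : Finset ℕ), a ≠ c → a ≠ d → b ≠ c → b ≠ d → c ≠ d →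
      (if (a, b) = (1, 1) ∨ (a, b) = (3, 3) ∨ (a, b) = (2, 4) then 0 else 1) + 1 ≤
      (if b = 4 then 1 else 0) + (if c = 2 then 1 else 0) + (if d = 2 then 1 else 0) := by
  decide

theorem necklace_inequality {c : Bool × Fin 4 → ℕ}
    (hc : IsListColouring necklace necklaceLists c) :
    (if c (false, 0) = 2 then 1 else 0) + (if c (false, 0) = 3 then 1 else 0) + 3 ≤
      (if c (true, 0) = 1 then 1 else 0) +
      ((if c (false, 0) = 3 then 1 else 0) + (if c (false, 2) = 4 then 1 else 0) +
        (if c (false, 3) = 4 then 1 else 0) + (if c (false, 1) = 3 then 1 else 0) +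
        (if c (false, 2) = 2 then 1 else 0) + (if c (false, 3) = 2 then 1 else 0)) +
      ((if c (true, 1) = 4 then 1 else 0) + (if c (true, 2) = 2 then 1 else 0) +
        (if c (true, 3) = 2 then 1 else 0)) := by
  have hl := diamond_inequality_left _ (hc.1 (false, 0)) _ (hc.1 (false, 1)) _ (hc.1 (false, 2))
    _ (hc.1 (false, 3)) (hc.2 _ _ (by decide)) (hc.2 _ _ (by decide)) (hc.2 _ _ (by decide))
    (hc.2 _ _ (by decide)) (hc.2 _ _ (by decide))
  have hr := diamond_inequality_right _ (hc.1 (true, 0)) _ (hc.1 (true, 1)) _ (hc.1 (true, 2))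
    _ (hc.1 (true, 3)) (hc.2 _ _ (by decide)) (hc.2 _ _ (by decide)) (hc.2 _ _ (by decide))
    (hc.2 _ _ (by decide)) (hc.2 _ _ (by decide))
  have h0 : c (false, 0) ≠ c (true, 0) := hc.2 _ _ (by decide)
  have h1 : c (false, 1) ≠ c (true, 1) := hc.2 _ _ (by decide)
  -- If both diamonds have listed pairs, then (2,3) and (3,4) on the left are compatible only with
  -- (1,1) on the right.
  have key : (if c (false, 0) = 2 then 1 else 0) + (if c (false, 0) = 3 then 1 else 0) ≤
      (if c (true, 0) = 1 then 1 else 0) +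
      (if (c (false, 0), c (false, 1)) = (1, 1) ∨ (c (false, 0), c (false, 1)) = (2, 3) ∨
        (c (false, 0), c (false, 1)) = (3, 4) then 0 else 1) +
      (if (c (true, 0), c (true, 1)) = (1, 1) ∨ (c (true, 0), c (true, 1)) = (3, 3) ∨
        (c (true, 0), c (true, 1)) = (2, 4) then 0 else 1) := by
    generalize c (false, 0) = x at *
    generalize c (false, 1) = y at *
    generalize c (true, 0) = x' at *
    generalize c (true, 1) = y' at *
    clear hl hr hc
    simp only [Prod.mk.injEq]
    split_ifs <;> omega
  omega

theorem sum_mul_ite_eq {Ω : Type} [Fintype Ω] {V : Type} (w : Ω → ℝ) (c : Ω → V → ℕ) (v : V)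
    (x : ℕ) : ∑ ω, w ω * (if c ω v = x then 1 else 0) = ∑ ω with c ω v = x, w ω := by
  simp [sum_filter]

theorem sum_weights_eq {Ω : Type} [Fintype Ω] {V : Type} {L : V → Finset ℕ} {w : Ω → ℝ}
    {c : Ω → V → ℕ} (hc : ∀ ω v, c ω v ∈ L v)
    (h : ∀ v, ∀ x ∈ L v, ∑ ω with c ω v = x, w ω = 1) (v : V) : ∑ ω, w ω = #(L v) := by
  rw [← sum_fiberwise_of_maps_to (t := L v) (g := fun ω => c ω v) (fun ω _ => hc ω v),
    sum_congr rfl (h v)]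
  simp

/-- Integrating `necklace_inequality` against weights of total 3, with every colour event of weight
1, gives 1 + 1 + 9 ≤ 1 + 6 + 3. -/
theorem necklace_not_three :
    fracChromaticNumber (listCover necklace necklaceLists) ≠ (3 : ℕ) := by
  intro h
  have hk : ∀ v, #(necklaceLists v) = 3 := by decide
  obtain ⟨Ω, _, w, c, hw, hc, hunif⟩ := exists_listColouring_weights hk h
  have htot := sum_weights_eq (fun ω => (hc ω).1) hunif (false, 0)
  have hI : ∀ v, ∀ x ∈ necklaceLists v, ∑ ω, w ω * (if c ω v = x then 1 else 0) = 1 :=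
    fun v x hx => (sum_mul_ite_eq w c v x).trans (hunif v x hx)
  have hle := sum_le_sum (s := univ) fun ω _ =>
    mul_le_mul_of_nonneg_left (Nat.cast_le (α := ℝ).2 (necklace_inequality (hc ω))) (hw ω).le
  push_cast at hle
  simp only [mul_add, sum_add_distrib, ← sum_mul] at hle
  rw [hI _ _ (by decide), hI _ _ (by decide), hI _ _ (by decide), hI _ _ (by decide),
    hI _ _ (by decide), hI _ _ (by decide), hI _ _ (by decide), hI _ _ (by decide),
    hI _ _ (by decide), hI _ _ (by decide), hI _ _ (by decide), htot, hk] at hle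
  norm_num at hle

/-- A graph with a clique of more than `k` vertices has a `k`-fold list-cover without any list
colouring. -/
theorem fracChromaticNumber_listCover_ne_of_clique {V : Type} [Fintype V] {G : SimpleGraph V}
    {k : ℕ} (hk : 1 ≤ k) {A : Finset V} (hA : G.IsClique (A : Set V)) (hkA : k < #A) :
    fracChromaticNumber (listCover G fun _ => range k) ≠ k := by
  intro h
  obtain ⟨Ω, _, w, c, hw, hc, hunif⟩ := exists_listColouring_weights (fun _ => card_range k) h
  obtain ⟨v, -⟩ : A.Nonempty := card_pos.1 (by omega)
  obtain ⟨ω, -⟩ := nonempty_of_sum_ne_zero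
    ((hunif v 0 (mem_range.2 hk)).trans_ne one_ne_zero)
  have := card_le_card_of_injOn (c ω) (s := A) (t := range k) (fun v _ => (hc ω).1 v)
    fun u hu v hv huv => by_contra fun hne => (hc ω).2 u v (hA hu hv hne) huv
  rw [card_range] at this
  omega

theorem fracListPackingNumber_necklace : fracListPackingNumber necklace = 4 := by
  refine IsLeast.csInf_eq ⟨⟨by norm_num, fun L hL => ?_⟩, ?_⟩
  · obtain ⟨c, hc, hne⟩ := necklace_packing L hL
    exact fracChromaticNumber_listCover_eq_of_packing hL c hc hne
  · rintro k ⟨hk, h⟩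
    by_contra hlt
    by_cases h3 : k = 3
    · subst h3
      exact necklace_not_three (h necklaceLists (by decide))
    · refine fracChromaticNumber_listCover_ne_of_clique hk
        (A := {(false, 0), (false, 2), (false, 3)}) ?_ ?_ (h _ fun _ => card_range k)
      · simp only [SimpleGraph.isClique_iff, Set.Pairwise]
        decide
      · have : #({(false, 0), (false, 2), (false, 3)} : Finset (Bool × Fin 4)) = 3 := by decide
        omega

theorem listPackingNumber_necklace : listPackingNumber necklace = 4 := by
  refine IsLeast.csInf_eq ⟨⟨by norm_num, necklace_packing⟩, ?_⟩
  rintro k ⟨hk, h⟩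
  rw [← fracListPackingNumber_necklace]
  refine Nat.sInf_le ⟨hk, fun L hL => ?_⟩
  obtain ⟨c, hc, hne⟩ := h L hL
  exact fracChromaticNumber_listCover_eq_of_packing hL c hc hne

end Necklace

/-! ### Complete bipartite graphs and correspondence packing -/

section CompleteBipartite

/-- The complete bipartite graph with parts `Fin k` and the set of all `k`-tuples of permutations of
`Fin (2 * k)`. -/
def permGraph (k : ℕ) : SimpleGraph (Fin k ⊕ (Fin k → Equiv.Perm (Fin (2 * k)))) :=
  completeBipartiteGraph _ _

variable {k m : ℕ}

/-- The relation defining the cover `permCover`. -/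
def permRel (hm : m ≤ 2 * k) (p q : (Fin k ⊕ (Fin k → Equiv.Perm (Fin (2 * k)))) × Fin m) : Prop :=
  p.1 = q.1 ∨ ∃ i π, p.1 = Sum.inl i ∧ q.1 = Sum.inr π ∧
    π i (Fin.castLE hm p.2) = Fin.castLE hm q.2

/-- The cover of `permGraph k` whose matchings are given by the tuples of permutations. -/
def permCover (hm : m ≤ 2 * k) :
    SimpleGraph ((Fin k ⊕ (Fin k → Equiv.Perm (Fin (2 * k)))) × Fin m) :=
  SimpleGraph.fromRel (permRel hm)

/-- The parts of `permCover`. -/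
def permPart (k m : ℕ) (v : Fin k ⊕ (Fin k → Equiv.Perm (Fin (2 * k)))) :
    Finset ((Fin k ⊕ (Fin k → Equiv.Perm (Fin (2 * k)))) × Fin m) :=
  univ.map ⟨Prod.mk v, Prod.mk_right_injective v⟩

theorem mem_permPart {v} {p : (Fin k ⊕ (Fin k → Equiv.Perm (Fin (2 * k)))) × Fin m} :
    p ∈ permPart k m v ↔ p.1 = v := by
  obtain ⟨u, x⟩ := p
  simp [permPart, eq_comm]

theorem card_permPart (v) : #(permPart k m v) = m := by simp [permPart]

theorem permCover_adj_inl_inr (hm : m ≤ 2 * k) (i π x y) :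
    (permCover hm).Adj (Sum.inl i, x) (Sum.inr π, y) ↔
      π i (Fin.castLE hm x) = Fin.castLE hm y := by
  simp [permCover, permRel]

theorem permCover_adj_inr_inl (hm : m ≤ 2 * k) (i π x y) :
    (permCover hm).Adj (Sum.inr π, y) (Sum.inl i, x) ↔
      π i (Fin.castLE hm x) = Fin.castLE hm y := by
  rw [SimpleGraph.adj_comm, permCover_adj_inl_inr]

theorem isCorrCover_permCover (hm : m ≤ 2 * k) :
    IsCorrCover (permGraph k) (permCover hm) (permPart k m) where
  cover p := ⟨p.1, mem_permPart.2 rfl⟩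
  disj u v h := disjoint_left.2 fun p hp hp' =>
    h ((mem_permPart.1 hp).symm.trans (mem_permPart.1 hp'))
  empty u v h hn p hp q hq hpq := by
    rw [mem_permPart] at hp hq
    subst hp hq
    obtain ⟨-, (h' | ⟨i, π, h1, h2, -⟩) | (h' | ⟨i, π, h1, h2, -⟩)⟩ := hpq
    · exact h h'
    · exact hn (by simp [permGraph, h1, h2])
    · exact h h'.symm
    · exact hn (by simp [permGraph, h1, h2])
  matching u v h p hp q hq r hr hpq hpr := by
    rw [mem_permPart] at hp hq hr
    obtain ⟨p1, p2⟩ := p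
    obtain ⟨q1, q2⟩ := q
    obtain ⟨r1, r2⟩ := r
    dsimp only at hp hq hr
    subst hp hq hr
    rcases p1 with i | π <;> rcases r1 with j | ρ
    · simp [permGraph] at h
    · rw [permCover_adj_inl_inr] at hpq hpr
      rw [Fin.castLE_injective hm (hpq.symm.trans hpr)]
    · rw [permCover_adj_inr_inl] at hpq hpr
      rw [Fin.castLE_injective hm ((π j).injective (hpq.trans hpr.symm))]
    · simp [permGraph] at h
  clique v p hp q hq h := by
    rw [mem_coe, mem_permPart] at hp hq
    exact ⟨h, Or.inl (Or.inl (hp.trans hq.symm))⟩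

/-- The rotation by `i` of the first `r` elements of `Fin m`. -/
theorem exists_rotation {r : ℕ} (hr : 0 < r) (hrm : r ≤ m) (i : ℕ) :
    ∃ τ : Equiv.Perm (Fin m), ∀ x : Fin m, (x : ℕ) < r → ((τ x : Fin m) : ℕ) = (x + i) % r := by
  have : NeZero r := ⟨hr.ne'⟩
  refine ⟨(Equiv.addRight (Fin.ofNat r i)).viaFintypeEmbedding (Fin.castLEEmb hrm), fun x hx => ?_⟩
  have h := (Equiv.addRight (Fin.ofNat r i)).viaFintypeEmbedding_apply_image
    (Fin.castLEEmb hrm) ⟨x, hx⟩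
  have hx' : Fin.castLEEmb hrm ⟨x, hx⟩ = x := rfl
  rw [hx'] at h
  rw [h]
  simp [Fin.val_add]

/-- Every tuple of perfect matchings of `m`-element parts occurs at some right vertex: extend the
permutations of `Fin m` to `Fin (2 * k)`. This makes the cover adversarial for every `m ≤ 2 * k`. -/
theorem exists_vertex_of_perms (hm : m ≤ 2 * k) (τ : Fin k → Equiv.Perm (Fin m)) :
    ∃ π : Fin k → Equiv.Perm (Fin (2 * k)), ∀ i x,
      π i (Fin.castLE hm x) = Fin.castLE hm (τ i x) :=
  ⟨fun i => (τ i).viaFintypeEmbedding (Fin.castLEEmb hm), fun i x =>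
    (τ i).viaFintypeEmbedding_apply_image (Fin.castLEEmb hm) x⟩

theorem not_colorable_permCover (hm1 : 1 ≤ m) (hm : m < 2 * k) :
    ¬ (permCover hm.le).Colorable m := by
  rintro ⟨C⟩
  have hinj : ∀ v, Injective fun x => C (v, x) := fun v x y h => by_contra fun hne =>
    C.valid (show (permCover hm.le).Adj (v, x) (v, y) from
      ⟨by simpa using hne, Or.inl (Or.inl rfl)⟩) h
  let e : ∀ v, Equiv.Perm (Fin m) := fun v => Equiv.ofBijective _
    (Finite.injective_iff_bijective.1 (hinj v))
  have he : ∀ v x, e v x = C (v, x) := fun v x => rfl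
  -- The side `r = min k m` of the forbidden square: `r` rotations need `r ≤ k` left vertices, and
  -- `2r > m` violates Hall's condition.
  obtain ⟨r, hr0, hrm, hrk, hr2⟩ : ∃ r, 0 < r ∧ r ≤ m ∧ r ≤ k ∧ m < 2 * r := by
    rcases le_total k m with h | h
    · exact ⟨k, by omega, h, le_rfl, hm⟩
    · exact ⟨m, by omega, le_rfl, h, by omega⟩
  choose τ hτ using fun i : ℕ => exists_rotation hr0 hrm i
  obtain ⟨π, hπ⟩ := exists_vertex_of_perms hm.le fun i => (e (Sum.inl i)).trans (τ i)
  -- Composing the `i`-th colouring with rotation by `i` makes each `y < r` adjacent, over all `i <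
  -- r`, to vertices of every colour `j < r`.
  have hmaps : ∀ y : Fin m, (y : ℕ) < r → r ≤ (C (Sum.inr π, y) : ℕ) := by
    intro y hy
    by_contra! hlt
    set j := C (Sum.inr π, y) with hj
    obtain ⟨i, hir, hi⟩ : ∃ i < r, (j + i) % r = y := by
      refine ⟨(y + (r - j)) % r, Nat.mod_lt _ hr0, ?_⟩
      rw [Nat.add_mod_mod, show (j : ℕ) + (y + (r - j)) = y + r by omega, Nat.add_mod_right,
        Nat.mod_eq_of_lt hy]
    have hadj := (permCover_adj_inl_inr hm.le ⟨i, hir.trans_le hrk⟩ π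
      ((e (Sum.inl ⟨i, hir.trans_le hrk⟩)).symm j) y).2 (by
        rw [hπ]
        refine congrArg _ (Fin.ext ?_)
        simp [hτ i j hlt, hi])
    refine C.valid hadj ?_
    rw [← he, Equiv.apply_symm_apply]
  have hcard := card_le_card_of_injOn (fun y => C (Sum.inr π, y))
    (s := {y : Fin m | (y : ℕ) < r}) (t := {y : Fin m | ¬ (y : ℕ) < r})
    (fun y hy => by simpa using hmaps y (by simpa using hy)) ((hinj _).injOn)
  have hsum := card_filter_add_card_filter_not (s := univ) (fun y : Fin m => (y : ℕ) < r)
  have h1 : #{y : Fin m | (y : ℕ) < r} = r := by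
    rw [Fin.card_filter_val_lt, min_eq_right hrm]
  rw [card_univ, Fintype.card_fin] at hsum
  omega

theorem fracChromaticNumber_permCover_ne (hm1 : 1 ≤ m) (hm : m ≤ 2 * k) (hmk : m ≤ k) :
    fracChromaticNumber (permCover hm) ≠ m := by
  classical
  intro h
  obtain ⟨Ω, _, w, c, -, hmem, hind, hunif⟩ := exists_weights_of_fracChromaticNumber_eq
    (isCorrCover_permCover hm) card_permPart h
  obtain ⟨ω, -⟩ := nonempty_of_sum_ne_zero
    ((hunif (Sum.inl ⟨0, by omega⟩) (_, ⟨0, hm1⟩) (mem_permPart.2 rfl)).trans_ne one_ne_zero)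
  have hfst : ∀ v, c ω v = (v, (c ω v).2) := fun v => Prod.ext (mem_permPart.1 (hmem ω v)) rfl
  -- Match the element chosen at left vertex `i` with `i % m`; as `m ≤ k`, every element of the part
  -- of `π` is then blocked.
  obtain ⟨π, hπ⟩ := exists_vertex_of_perms hm fun i : Fin k =>
    Equiv.swap (c ω (Sum.inl i)).2 ⟨i % m, Nat.mod_lt _ hm1⟩
  set y := (c ω (Sum.inr π)).2 with hy
  refine hind ω (Sum.inl ⟨y, y.2.trans_le hmk⟩) (Sum.inr π) ?_
  rw [hfst, hfst (Sum.inr π), permCover_adj_inl_inr, hπ, Equiv.swap_apply_left]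
  exact congrArg _ (Fin.ext (Nat.mod_eq_of_lt y.2))

/-! ### Upper bounds for complete bipartite graphs -/

section UpperBounds

variable {B W : Type} {H : SimpleGraph W} {L : Fin k ⊕ B → Finset W}

theorem IsCorrCover.not_adj_of_isLeft_eq (hc : IsCorrCover (completeBipartiteGraph (Fin k) B) H L)
    {u v : Fin k ⊕ B} (huv : u.isLeft = v.isLeft) {f : Fin k ⊕ B → W} (hf : ∀ v, f v ∈ L v) :
    ¬ H.Adj (f u) (f v) := by
  by_cases h : u = v
  · simp [h]
  · refine hc.empty u v h ?_ _ (hf u) _ (hf v)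
    rcases u with u | u <;> rcases v with v | v <;> simp_all

/-- Order the left parts arbitrarily; each right vertex has only `k` neighbours, half of the `2 * k`
colours, and right vertices do not interact. -/
theorem exists_packing_completeBipartiteGraph
    (hc : IsCorrCover (completeBipartiteGraph (Fin k) B) H L) (hL : ∀ v, #(L v) = 2 * k) :
    ∃ σ : Fin k ⊕ B → Fin (2 * k) → W, IsPacking H L σ := by
  let σ₀ : Fin k ⊕ B → Fin (2 * k) → W := fun v i =>
    ((L v).equivFin.symm (Fin.cast (hL v).symm i)).1
  have hσ₀ : ∀ v, Injective (σ₀ v) := fun v i j h => by simpa [σ₀] using h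
  have hσ₀' : ∀ v i, σ₀ v i ∈ L v := fun v i => by simp [σ₀]
  choose f hf hf' hf'' using fun b : B => hc.exists_extension (hL (Sum.inr b))
    (U := univ.map Embedding.inl) (by simp) (by simp) σ₀ (fun u _ => hσ₀ u) (fun u _ => hσ₀' u)
  let σ : Fin k ⊕ B → Fin (2 * k) → W := Sum.elim (fun i => σ₀ (Sum.inl i)) f
  have hmem : ∀ v i, σ v i ∈ L v := by
    rintro (u | b) i
    · exact hσ₀' _ i
    · exact hf' b i
  refine ⟨σ, ?_, hmem, ?_⟩
  · rintro (u | b)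
    · exact hσ₀ _
    · exact hf b
  · rintro (u | b) (u' | b') i
    · exact hc.not_adj_of_isLeft_eq (u := Sum.inl u) (v := Sum.inl u') (f := fun v => σ v i) rfl fun v => hmem v i
    · exact hf'' b' _ (by simp) i
    · exact fun h => hf'' b (Sum.inl u') (by simp) i h.symm
    · exact hc.not_adj_of_isLeft_eq (u := Sum.inr b) (v := Sum.inr b') (f := fun v => σ v i) rfl fun v => hmem v i

/-- A random variable in a finite group whose distribution is translation-invariant is uniform. -/
theorem sum_weight_eq_one_of_equivariant {Ω A : Type} [Fintype Ω] [Nonempty Ω] [Fintype A]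
    [DecidableEq A] [AddCommGroup A] (z : Ω → A)
    (h : ∀ s, ∃ T : Equiv.Perm Ω, ∀ ω, z (T ω) = z ω + s) (y : A) :
    ∑ ω with z ω = y, (Fintype.card A / Fintype.card Ω : ℝ) = 1 := by
  have hcard : ∀ y', #{ω | z ω = y'} = #{ω | z ω = y} := by
    intro y'
    obtain ⟨T, hT⟩ := h (y - y')
    refine card_bij (fun ω _ => T ω) (fun ω hω => ?_) (fun _ _ _ _ h => T.injective h)
      fun ω hω => ⟨T.symm ω, ?_, by simp⟩
    · simp only [mem_filter, mem_univ, true_and] at hω ⊢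
      rw [hT, hω]
      abel
    · have := hT (T.symm ω)
      simp only [mem_filter, mem_univ, true_and, Equiv.apply_symm_apply] at hω this ⊢
      rw [hω] at this
      have h2 : z (T.symm ω) = y - (y - y') := eq_sub_of_add_eq this.symm
      rw [h2]
      abel
  have htot : Fintype.card Ω = Fintype.card A * #{ω | z ω = y} := by
    rw [← card_univ, card_eq_sum_card_fiberwise (f := z) (t := univ) (by simp),
      sum_congr rfl fun y' _ => hcard y']
    simp
  have h0 : (Fintype.card Ω : ℝ) ≠ 0 := by exact_mod_cast Fintype.card_ne_zero
  rw [sum_const, nsmul_eq_mul, ← mul_div_assoc, div_eq_one_iff_eq h0, htot]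
  push_cast
  ring

/-- Identify the parts with `ZMod (k + 1)` and colour the left side uniformly at random. Each right
vertex takes an unblocked element, chosen so that it shifts along with the blocked ones and hence is
uniform. -/
theorem fracChromaticNumber_completeBipartiteGraph [Fintype W] (hk : 1 ≤ k)
    (hc : IsCorrCover (completeBipartiteGraph (Fin k) B) H L) (hL : ∀ v, #(L v) = k + 1) :
    fracChromaticNumber H = (k + 1 : ℕ) := by
  classical
  let i₀ : Fin k := ⟨0, hk⟩
  have : Nonempty (Fin k ⊕ B) := ⟨Sum.inl i₀⟩
  let Z := ZMod (k + 1)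
  let e : ∀ v, Z ≃ L v := fun v => Fintype.equivOfCardEq (by simp [Z, hL, ZMod.card])
  have hadj : ∀ i b, (completeBipartiteGraph (Fin k) B).Adj (Sum.inl i) (Sum.inr b) := by simp
  have hψ : ∀ i b, ∃ ψ : Equiv.Perm Z, ∀ x y,
      H.Adj (e (Sum.inl i) x) (e (Sum.inr b) y) → ψ x = y := by
    intro i b
    let f : Z → Z := fun x => if h : ∃ y, H.Adj (e (Sum.inl i) x) (e (Sum.inr b) y)
      then h.choose else 0
    have hf : ∀ x y, H.Adj (e (Sum.inl i) x) (e (Sum.inr b) y) → f x = y := by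
      intro x y h
      have hex : ∃ y, H.Adj (e (Sum.inl i) x) (e (Sum.inr b) y) := ⟨y, h⟩
      have h1 : f x = hex.choose := dif_pos hex
      rw [h1]
      exact (e (Sum.inr b)).injective (Subtype.ext (hc.matching _ _ (hadj i b) _ (e _ x).2 _
        (e _ _).2 _ (e _ y).2 hex.choose_spec h))
    -- The matching may be partial; completing it to a permutation only adds constraints.
    obtain ⟨g, hg⟩ := exists_equiv_extend_of_card_eq (α := Z) (β := Z) (t := univ) (by simp)
      (s := {x | ∃ y, H.Adj (e (Sum.inl i) x) (e (Sum.inr b) y)}) (f := f) (subset_univ _) (by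
        intro x hx x' hx' hxx
        simp only [coe_filter, mem_univ, true_and, Set.mem_ofPred_eq] at hx hx'
        obtain ⟨y, hy⟩ := hx
        obtain ⟨y', hy'⟩ := hx'
        rw [hf x y hy, hf x' y' hy'] at hxx
        subst hxx
        exact (e (Sum.inl i)).injective (Subtype.ext (hc.matching _ _ (hadj i b).symm _ (e _ y).2 _
          (e _ x).2 _ (e _ x').2 hy.symm hy'.symm)))
    refine ⟨g.trans (Equiv.subtypeUnivEquiv mem_univ), fun x y h => ?_⟩
    rw [← hf x y h]
    exact hg x (by simpa using ⟨y, h⟩)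
  choose ψ hψ using hψ
  have hfree : ∀ F : Fin k → Z, ∃ y, ∀ i, F i ≠ y := by
    intro F
    by_contra! hs
    have := Fintype.card_le_of_surjective F hs
    simp [Z, ZMod.card] at this
  choose g hg using hfree
  let F : B → (Fin k → Z) → Fin k → Z := fun b ω i => ψ i b (ω i)
  -- Normalising the blocked tuple by its entry at `i₀` before applying `g` makes the choice commute
  -- with translations.
  let z : (Fin k → Z) → Fin k ⊕ B → Z := fun ω => Sum.elim ω
    fun b => F b ω i₀ + g fun i => F b ω i - F b ω i₀
  have hz : ∀ ω i b, ψ i b (ω i) ≠ z ω (Sum.inr b) := fun ω i b h =>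
    hg (fun i => F b ω i - F b ω i₀) i (sub_eq_iff_eq_add'.2 h)
  have hequi : ∀ v s, ∃ T : Equiv.Perm (Fin k → Z), ∀ ω, z (T ω) v = z ω v + s := by
    rintro (i | b) s
    · exact ⟨Equiv.addRight fun _ => s, fun ω => rfl⟩
    -- Conjugating the translation by each `ψ i b` shifts all elements blocked at `b` by `s`.
    · refine ⟨Equiv.piCongrRight fun i => ((ψ i b).trans (Equiv.addRight s)).trans (ψ i b).symm,
        fun ω => ?_⟩
      simp only [z, F, Sum.elim_inr, Equiv.piCongrRight_apply, Pi.map_apply, Equiv.trans_apply,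
        Equiv.coe_addRight, Equiv.apply_symm_apply, add_sub_add_right_eq_sub]
      abel
  refine fracChromaticNumber_eq_of_weights hc hL
    (fun _ : Fin k → Z => (Fintype.card Z / Fintype.card (Fin k → Z) : ℝ)) (fun _ => by positivity)
    (fun ω v => e v (z ω v)) (fun ω v => (e v _).2) ?_ ?_
  · rintro ω (i | b) (i' | b')
    · exact hc.not_adj_of_isLeft_eq (u := Sum.inl i) (v := Sum.inl i')
        (f := fun v => e v (z ω v)) rfl fun v => (e v _).2
    · exact fun h => hz ω i b' (hψ i b' _ _ h)
    · exact fun h => hz ω i' b (hψ i' b _ _ h.symm)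
    · exact hc.not_adj_of_isLeft_eq (u := Sum.inr b) (v := Sum.inr b')
        (f := fun v => e v (z ω v)) rfl fun v => (e v _).2
  · intro v x hx
    obtain ⟨y, hy⟩ := (e v).surjective ⟨x, hx⟩
    rw [← sum_weight_eq_one_of_equivariant (fun ω => z ω v) (hequi v) y]
    refine sum_congr (Finset.ext fun ω => ?_) fun _ _ => rfl
    simp only [mem_filter, mem_univ, true_and]
    rw [← (e v).apply_eq_iff_eq, hy, Subtype.ext_iff]

end UpperBounds

theorem corrPackingNumber_permGraph (hk : 1 ≤ k) : corrPackingNumber (permGraph k) = 2 * k := by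
  refine IsLeast.csInf_eq ⟨⟨by omega, fun W _ H L hc hL => ?_⟩, ?_⟩
  · obtain ⟨σ, hσ⟩ := exists_packing_completeBipartiteGraph hc hL
    refine le_antisymm (hσ.colorable hc hL).chromaticNumber_le ?_
    rw [← hL (Sum.inl ⟨0, hk⟩)]
    exact (hc.clique _).card_le_chromaticNumber
  · rintro m ⟨hm, h⟩
    by_contra! hlt
    refine not_colorable_permCover hm hlt ?_
    rw [← SimpleGraph.chromaticNumber_le_iff_colorable,
      h _ _ _ (isCorrCover_permCover hlt.le) card_permPart]

theorem fracCorrPackingNumber_permGraph (hk : 1 ≤ k) :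
    fracCorrPackingNumber (permGraph k) = k + 1 := by
  refine IsLeast.csInf_eq ⟨⟨by omega, fun W _ H L hc hL =>
    fracChromaticNumber_completeBipartiteGraph hk hc hL⟩, ?_⟩
  rintro m ⟨hm, h⟩
  by_contra! hlt
  exact fracChromaticNumber_permCover_ne hm (by omega) (by omega)
    (h _ _ _ (isCorrCover_permCover _) card_permPart)

end CompleteBipartite

/-! ### A `d`-degenerate chain of cliques -/

section Chain

/-- The relation defining `chainGraph`. -/
def chainRel (d : ℕ) :
    Option (Fin (3 * d) × Fin (d + 1)) → Option (Fin (3 * d) × Fin (d + 1)) → Prop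
  | some (t, i), some (t', j) => t = t' ∨ ((t' : ℕ) = t + 1 ∧ i ≠ 0 ∧ j = 0)
  | none, some (t, j) => (t : ℕ) % 3 = 0 ∧ j = 0
  | _, none => False

/-- A chain of `3 * d` cliques of size `d + 1`, where the vertex `0` of each clique is joined to all
vertices but `0` of the preceding clique, and an additional vertex `none` is joined to the vertex
`0` of every third clique. -/
def chainGraph (d : ℕ) : SimpleGraph (Option (Fin (3 * d) × Fin (d + 1))) :=
  SimpleGraph.fromRel (chainRel d)

variable {d : ℕ}

theorem chainGraph_adj_level (t : Fin (3 * d)) {i j : Fin (d + 1)} (h : i ≠ j) :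
    (chainGraph d).Adj (some (t, i)) (some (t, j)) :=
  ⟨by simpa using h, Or.inl (Or.inl rfl)⟩

theorem chainGraph_adj_step {t t' : Fin (3 * d)} (h : (t' : ℕ) = t + 1) {i : Fin (d + 1)}
    (hi : i ≠ 0) : (chainGraph d).Adj (some (t, i)) (some (t', 0)) :=
  ⟨by simp [hi], Or.inl (Or.inr ⟨h, hi, rfl⟩)⟩

theorem chainGraph_adj_none {t : Fin (3 * d)} (h : (t : ℕ) % 3 = 0) :
    (chainGraph d).Adj none (some (t, 0)) :=
  ⟨by simp, Or.inl ⟨h, rfl⟩⟩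

theorem chainGraph_adj_none_iff {v : Option (Fin (3 * d) × Fin (d + 1))} :
    (chainGraph d).Adj none v ↔ ∃ t : Fin (3 * d), (t : ℕ) % 3 = 0 ∧ v = some (t, 0) := by
  constructor
  · rcases v with _ | ⟨t, i⟩
    · simp
    · rintro ⟨-, ⟨h, rfl⟩ | h⟩
      · exact ⟨t, h, rfl⟩
      · exact h.elim
  · rintro ⟨t, h, rfl⟩
    exact chainGraph_adj_none h

/-- The cliques of `chainGraph`. -/
def chainLevel (t : Fin (3 * d)) : Finset (Option (Fin (3 * d) × Fin (d + 1))) :=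
  univ.map ⟨fun i => some (t, i), fun i j h => by simpa using h⟩

theorem card_chainLevel (t : Fin (3 * d)) : #(chainLevel t) = d + 1 := by simp [chainLevel]

theorem chainGraph_clique (t : Fin (3 * d)) :
    (chainGraph d).IsClique (chainLevel t : Set (Option (Fin (3 * d) × Fin (d + 1)))) := by
  intro u hu v hv h
  simp only [chainLevel, coe_map, coe_univ, Set.image_univ, Set.mem_range] at hu hv
  obtain ⟨i, rfl⟩ := hu
  obtain ⟨j, rfl⟩ := hv
  exact chainGraph_adj_level t fun hij => h (by rw [hij])

theorem degeneracy_chainGraph (hd : 1 ≤ d) : degeneracy (chainGraph d) = d := by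
  classical
  have h0 : 0 < 3 * d := by omega
  refine IsLeast.csInf_eq ⟨fun S hS => ?_, fun d' h => ?_⟩
  · by_cases hnone : none ∈ S
    · refine ⟨none, hnone, ?_⟩
      have hsub : {u ∈ S | (chainGraph d).Adj none u} ⊆ univ.image fun i : Fin d =>
          some ((⟨3 * i, by omega⟩ : Fin (3 * d)), (0 : Fin (d + 1))) := by
        intro u hu
        obtain ⟨t, ht, rfl⟩ := chainGraph_adj_none_iff.1 (mem_filter.1 hu).2
        refine mem_image.2 ⟨⟨t / 3, by omega⟩, mem_univ _, ?_⟩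
        simp only [Option.some.injEq, Prod.mk.injEq, and_true, Fin.ext_iff]
        omega
      convert (card_le_card hsub).trans card_image_le using 1
      · congr
      · simp
    -- Without `none`, take the lexicographically last vertex: its neighbours in `S` lie in the
    -- preceding clique if its index is 0, and in its own clique otherwise.
    · obtain ⟨v, hv, hmax⟩ := S.exists_max_image
        (fun v => v.elim 0 fun p => p.1.val * (d + 1) + p.2.val) hS
      rcases v with _ | ⟨t, i⟩
      · exact (hnone hv).elim
      refine ⟨_, hv, ?_⟩
      have hlex : ∀ t' j, some (t', j) ∈ S → t' = t ∨ (t' : ℕ) < t := by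
        intro t' j hj
        have := hmax _ hj
        simp only [Option.elim_some] at this
        by_contra! hlt
        have h1 : (t : ℕ) + 1 ≤ t' := by
          have := Fin.val_ne_of_ne hlt.1
          omega
        have h2 := Nat.mul_le_mul_right (d + 1) h1
        have := i.2
        rw [add_mul] at h2
        omega
      have hlex' : ∀ j, some (t, j) ∈ S → j ≤ i := by
        intro j hj
        have := hmax _ hj
        simp only [Option.elim_some] at this
        exact Fin.le_def.2 (by omega)
      have hcard : ∀ (T : Finset (Option (Fin (3 * d) × Fin (d + 1)))) (s : Fin (3 * d))
          (j : Fin (d + 1)), T ⊆ (univ.erase j).image (fun j' => some (s, j')) → #T ≤ d := by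
        intro T s j hT
        refine (card_le_card hT).trans (card_image_le.trans ?_)
        simp
      by_cases hi : i = 0
      · subst hi
        have hadj : ∀ u ∈ S, (chainGraph d).Adj (some (t, 0)) u →
            ∃ t' j, u = some (t', j) ∧ j ≠ 0 ∧ (t : ℕ) = t' + 1 := by
          rintro (_ | ⟨t', j⟩) hu ⟨hne, h⟩
          · exact (hnone hu).elim
          refine ⟨t', j, rfl, ?_⟩
          rcases h with (h | ⟨-, h, -⟩) | (h | ⟨h1, h2, -⟩)
          · subst h
            have := hlex' j hu
            simp only [Fin.le_zero_iff] at this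
            subst this
            exact (hne rfl).elim
          · exact (h rfl).elim
          · subst h
            have := hlex' j hu
            simp only [Fin.le_zero_iff] at this
            subst this
            exact (hne rfl).elim
          · exact ⟨h2, h1⟩
        convert hcard {u ∈ S | (chainGraph d).Adj (some (t, 0)) u} ⟨t - 1, by omega⟩ 0 ?_
        intro u hu
        obtain ⟨t', j, rfl, hj, ht⟩ := hadj u (mem_filter.1 hu).1 (mem_filter.1 hu).2
        refine mem_image.2 ⟨j, by simpa using hj, ?_⟩
        simp [ht]
      · convert hcard {u ∈ S | (chainGraph d).Adj (some (t, i)) u} t i ?_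
        intro u hu
        obtain ⟨hu, hne, h⟩ := mem_filter.1 hu
        rcases u with _ | ⟨t', j⟩
        · exact (hnone hu).elim
        rcases h with (h | ⟨h1, -, -⟩) | (h | ⟨-, -, h⟩)
        · subst h
          exact mem_image.2 ⟨j, by simpa [eq_comm] using hne, rfl⟩
        · rcases hlex t' j hu with rfl | h <;> omega
        · subst h
          exact mem_image.2 ⟨j, by simpa [eq_comm] using hne, rfl⟩
        · exact (hi h).elim
  · obtain ⟨v, hv, hle⟩ := h (chainLevel ⟨0, h0⟩)
      (card_pos.1 (by rw [card_chainLevel]; omega))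
    have hclique := chainGraph_clique (d := d) ⟨0, h0⟩
    have h2 := card_chainLevel (d := d) ⟨0, h0⟩
    set A := chainLevel (d := d) ⟨0, h0⟩
    have hsub : A.erase v ⊆ {u ∈ A | (chainGraph d).Adj v u} := fun u hu =>
      mem_filter.2 ⟨mem_of_mem_erase hu,
        hclique hv (mem_of_mem_erase hu) (ne_of_mem_erase hu).symm⟩
    have h1 := card_le_card hsub
    rw [card_erase_of_mem hv] at h1
    have h3 : #{u ∈ A | (chainGraph d).Adj v u} ≤ d' := by convert hle
    omega

/-- The colours of the lists along the chain: only the colours with index `0` and `1` move. -/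
def chainColour (d t m : ℕ) : ℕ :=
  if m = 0 then if t % 3 = 2 then (t / 3 + 1) % d else t / 3
  else if m = 1 then if t % 3 = 0 then (t / 3 + 1) % d else d + 1
  else d + m

theorem succ_mod_ne (hd : 2 ≤ d) {i : ℕ} (hi : i < d) : (i + 1) % d ≠ i := by
  rcases Nat.lt_or_ge (i + 1) d with h | h
  · rw [Nat.mod_eq_of_lt h]
    omega
  · rw [show i + 1 = d by omega, Nat.mod_self]
    omega

theorem chainColour_injective (hd : 2 ≤ d) {t : ℕ} (ht : t < 3 * d) :
    Injective (chainColour d t) := by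
  have h1 := Nat.mod_lt (t / 3 + 1) (show 0 < d by omega)
  have h2 : t / 3 < d := by omega
  have h3 := succ_mod_ne hd h2
  intro m m' h
  unfold chainColour at h
  generalize (t / 3 + 1) % d = x at *
  split_ifs at h <;> omega

/-- Within a period of three steps the pair of moving colours goes `(i, i+1)`, `(i, d+1)`, `(i+1,
d+1)`, `(i+1, i+2)`, with entries below `d` taken modulo `d`. Parking index 1 at the spare colour `d
+ 1` lets each step change a single colour. -/
theorem chainColour_succ (hd : 2 ≤ d) {t : ℕ} (ht : t + 1 < 3 * d) :
    ∃ s < 2, chainColour d t s ≠ chainColour d (t + 1) s ∧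
      ∀ m, m ≠ s → chainColour d (t + 1) m = chainColour d t m := by
  have h1 := Nat.mod_lt (t / 3 + 1) (show 0 < d by omega)
  have h1' := Nat.mod_lt ((t + 1) / 3 + 1) (show 0 < d by omega)
  have h2 : t / 3 < d := by omega
  have h3 := succ_mod_ne hd h2
  have h : t % 3 = 0 ∨ t % 3 = 1 ∨ t % 3 = 2 := by omega
  rcases h with h | h | h
  · have e1 : (t + 1) % 3 = 1 := by omega
    have e2 : (t + 1) / 3 = t / 3 := by omega
    refine ⟨1, by norm_num, ?_, fun m hm => ?_⟩
    · simp [chainColour, h, e1]; omega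
    · simp [chainColour, h, e1, e2, hm]
  · have e1 : (t + 1) % 3 = 2 := by omega
    have e2 : (t + 1) / 3 = t / 3 := by omega
    refine ⟨0, by norm_num, ?_, fun m hm => ?_⟩
    · simp [chainColour, h, e1, e2]; omega
    · simp [chainColour, h, e1, hm]
  · have e1 : (t + 1) % 3 = 0 := by omega
    have e2 : (t + 1) / 3 = t / 3 + 1 := by omega
    have e3 : (t / 3 + 1) % d = t / 3 + 1 := Nat.mod_eq_of_lt (by omega)
    refine ⟨1, by norm_num, ?_, fun m hm => ?_⟩
    · simp [chainColour, h, e1]; omega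
    · simp [chainColour, h, e1, e2, e3, hm]

/-- The list-assignment of `chainGraph d` without a fractional packing. -/
def chainLists (d : ℕ) (v : Option (Fin (3 * d) × Fin (d + 1))) : Finset ℕ :=
  v.elim (range (d + 1)) fun p => (range (d + 1)).image (chainColour d p.1)

theorem card_chainLists (hd : 2 ≤ d) (v) : #(chainLists d v) = d + 1 := by
  rcases v with _ | ⟨t, i⟩
  · simp [chainLists]
  · simp [chainLists, card_image_of_injective _ (chainColour_injective hd t.2)]

theorem chainColour_mem {t : Fin (3 * d)} {i : Fin (d + 1)} {m : ℕ} (hm : m < d + 1) :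
    chainColour d t m ∈ chainLists d (some (t, i)) :=
  mem_image_of_mem _ (mem_range.2 hm)

theorem chain_level_surjective (hd : 2 ≤ d) {c : Option (Fin (3 * d) × Fin (d + 1)) → ℕ}
    (hc : IsListColouring (chainGraph d) (chainLists d) c) (t : Fin (3 * d)) {m : ℕ}
    (hm : m < d + 1) : ∃ i, c (some (t, i)) = chainColour d t m := by
  refine exists_eq_of_injective (card_chainLists hd (some (t, 0)))
    (f := fun i => c (some (t, i))) (fun i j h => by_contra fun hne => ?_)
    (fun i => hc.1 (some (t, i))) (chainColour_mem hm)
  exact hc.2 _ _ (chainGraph_adj_level t hne) h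

/-- The next vertex `0` avoids every colour on the other vertices of this clique, so it keeps the
index or takes the new colour, of index `s`. Index `s` always persists and has weight 1 at both
levels, so no other index can turn into it. -/
theorem chain_step (hd : 2 ≤ d) {Ω : Type} [Fintype Ω] {w : Ω → ℝ}
    {c : Ω → Option (Fin (3 * d) × Fin (d + 1)) → ℕ} (hw : ∀ ω, 0 < w ω)
    (hc : ∀ ω, IsListColouring (chainGraph d) (chainLists d) (c ω))
    (hunif : ∀ v, ∀ x ∈ chainLists d v, ∑ ω with c ω v = x, w ω = 1)
    {t t' : Fin (3 * d)} (ht : (t' : ℕ) = t + 1) {ω : Ω} {m : ℕ}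
    (h : c ω (some (t, 0)) = chainColour d t m) : c ω (some (t', 0)) = chainColour d t' m := by
  obtain ⟨s, hs, hsne, hseq⟩ := chainColour_succ hd (ht ▸ t'.2)
  rw [← ht] at hsne hseq
  have hinj := chainColour_injective hd t.2
  have key : ∀ ω m, c ω (some (t, 0)) = chainColour d t m →
      c ω (some (t', 0)) = chainColour d t' m ∨ c ω (some (t', 0)) = chainColour d t' s := by
    intro ω m h
    obtain ⟨m', hm', he⟩ := mem_image.1 ((hc ω).1 (some (t', 0)))
    rw [mem_range] at hm'
    dsimp only at he
    by_cases hms : m' = s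
    · rw [← he, hms]; exact Or.inr rfl
    left
    obtain ⟨i, hi⟩ := chain_level_surjective hd (hc ω) t hm'
    have hi0 : i = 0 := by
      by_contra hi0
      refine (hc ω).2 _ _ (chainGraph_adj_step ht hi0) ?_
      rw [hi, ← he, hseq m' hms]
    rw [hi0, h] at hi
    rw [← he, hinj hi]
  have hsd : s < d + 1 := by omega
  have hsub : ({ω | c ω (some (t, 0)) = chainColour d t s} : Finset Ω) ⊆
      ({ω | c ω (some (t', 0)) = chainColour d t' s} : Finset Ω) := by
    intro ω hω
    simp only [mem_filter, mem_univ, true_and] at hω ⊢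
    exact (key ω s hω).elim id id
  rcases key ω m h with h' | h'
  · exact h'
  rw [h']
  by_contra hne
  have hms : m ≠ s := fun hms => hne (by rw [hms])
  -- Otherwise `ω`, of positive weight, lies in the second event but not in the first.
  refine (sum_lt_sum_of_subset hsub (i := ω) (f := w) (by simpa using h') ?_ (hw ω)
    fun ω _ _ => (hw ω).le).ne ?_
  · simpa [h] using hinj.ne hms
  · rw [hunif _ _ (chainColour_mem hsd), hunif _ _ (chainColour_mem hsd)]

theorem fracChromaticNumber_chainLists_ne (hd : 2 ≤ d) :
    fracChromaticNumber (listCover (chainGraph d) (chainLists d)) ≠ (d + 1 : ℕ) := by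
  classical
  intro h
  obtain ⟨Ω, _, w, c, hw, hc, hunif⟩ := exists_listColouring_weights (card_chainLists hd) h
  have h0 : 0 < 3 * d := by omega
  have hprop : ∀ ω m, c ω (some (⟨0, h0⟩, 0)) = chainColour d 0 m →
      ∀ t (ht : t < 3 * d), c ω (some (⟨t, ht⟩, 0)) = chainColour d t m := by
    intro ω m h t
    induction t with
    | zero => exact fun _ => h
    | succ t ih =>
      exact fun ht => chain_step hd hw hc hunif (t := ⟨t, by omega⟩) rfl (ih (by omega))
  -- At the levels divisible by 3, index 0 shows the colour `j` and index 1 the colour `(j + 1) %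
  -- d`; over `j < d` either exhausts the colours below `d`.
  have hforced : ∀ ω, ∀ m < 2, c ω (some (⟨0, h0⟩, 0)) = chainColour d 0 m → c ω none = d := by
    intro ω m hm h
    have hlt := mem_range.1 ((hc ω).1 none)
    by_contra hne
    have hlt : c ω none < d := by omega
    have hall : ∀ j < d, c ω none ≠ chainColour d (3 * j) m := by
      intro j hj
      rw [← hprop ω m h (3 * j) (by omega)]
      exact (hc ω).2 _ _ (chainGraph_adj_none (by simp))
    interval_cases m
    · exact hall _ hlt (by simp [chainColour])
    -- The `j` for which `j + 1` is the colour of `none` modulo `d`.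
    · refine hall ((c ω none + (d - 1)) % d) (Nat.mod_lt _ (by omega)) ?_
      simp only [chainColour]
      simp [show c ω none + (d - 1) + 1 = c ω none + d by omega, Nat.mod_eq_of_lt hlt]
  have hx := hunif none d (by simp [chainLists])
  have h1 := hunif (some (⟨0, h0⟩, 0)) _ (chainColour_mem (m := 0) (by omega))
  have h2 := hunif (some (⟨0, h0⟩, 0)) _ (chainColour_mem (m := 1) (by omega))
  have hdisj : Disjoint ({ω | c ω (some (⟨0, h0⟩, 0)) = chainColour d 0 0} : Finset Ω)
      ({ω | c ω (some (⟨0, h0⟩, 0)) = chainColour d 0 1} : Finset Ω) := by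
    refine disjoint_filter.2 fun ω _ h h' => ?_
    exact absurd (chainColour_injective hd h0 (h.symm.trans h')) (by norm_num)
  -- Two disjoint events of weight 1 lie inside one event of weight 1.
  have hle := sum_le_sum_of_subset_of_nonneg (f := w)
    (union_subset (s := ({ω | c ω (some (⟨0, h0⟩, 0)) = chainColour d 0 0} : Finset Ω))
      (t := ({ω | c ω (some (⟨0, h0⟩, 0)) = chainColour d 0 1} : Finset Ω))
      (u := ({ω | c ω none = d} : Finset Ω))
      (fun ω hω => by simpa using hforced ω 0 (by norm_num) (by simpa using hω))
      (fun ω hω => by simpa using hforced ω 1 (by norm_num) (by simpa using hω)))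
    (fun ω _ _ => (hw ω).le)
  rw [sum_union hdisj, hx, h1, h2] at hle
  norm_num at hle

theorem le_fracListPackingNumber_chainGraph (hd : 2 ≤ d) :
    d + 2 ≤ fracListPackingNumber (chainGraph d) := by
  refine le_csInf (exists_fracListPacking (chainGraph d)) ?_
  rintro k ⟨hk, h⟩
  by_contra! hlt
  by_cases hkd : k = d + 1
  · subst hkd
    exact fracChromaticNumber_chainLists_ne hd (h _ (card_chainLists hd))
  · exact fracChromaticNumber_listCover_ne_of_clique hk (chainGraph_clique ⟨0, by omega⟩)
      (by rw [card_chainLevel]; omega) (h _ fun _ => card_range k)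

end Chain

end ListPacking

theorem theorem1p8 :
    (∀ d : ℕ, 2 ≤ d → ∃ (V : Type) (_ : Fintype V) (G : SimpleGraph V),
      ListPacking.degeneracy G = d ∧ d + 2 ≤ ListPacking.fracListPackingNumber G) ∧
    (∀ k : ℕ, 2 ≤ k → ∃ (V : Type) (_ : Fintype V) (G : SimpleGraph V),
      ListPacking.fracCorrPackingNumber G = k + 1 ∧ ListPacking.corrPackingNumber G = 2 * k) ∧
    (ListPacking.necklace.Connected ∧
      ListPacking.necklace.IsRegularOfDegree 3 ∧
      IsEmpty (ListPacking.necklace ≃g (⊤ : SimpleGraph (Fin 4))) ∧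
      ListPacking.fracListPackingNumber ListPacking.necklace = 4 ∧
      ListPacking.listPackingNumber ListPacking.necklace = 4) :=
  ⟨fun d hd => ⟨_, inferInstance, ListPacking.chainGraph d,
      ListPacking.degeneracy_chainGraph (by omega),
      ListPacking.le_fracListPackingNumber_chainGraph hd⟩,
    fun k hk => ⟨_, inferInstance, ListPacking.permGraph k,
      ListPacking.fracCorrPackingNumber_permGraph (by omega),
      ListPacking.corrPackingNumber_permGraph (by omega)⟩,
    ListPacking.necklace_connected, ListPacking.necklace_regular, ListPacking.necklace_not_iso,
    ListPacking.fracListPackingNumber_necklace, ListPacking.listPackingNumber_necklace⟩
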